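/- Let $d\ge 2$, let $\mathbb N^d$ (positive integer coordinates) carry the coordinatewise order, and put $|\mathbf n|=n_1\cdots n_d$. Let $\{X_{\mathbf n},\ \mathbf n\in\mathbb N^d\}$ be integrable real random variables on a probability space with $EX_{\mathbf n}=0$, and let $S_{\mathbf n}=\sum_{\mathbf k\le\mathbf n}X_{\mathbf k}$. Assume that the field is negatively dependent (ND): for every finite $J\subset\mathbb N^d$ and all real $x_{\mathbf j}$, $$P\Big(\bigcap_{\mathbf j\in J}\{X_{\mathbf j}\le x_{\mathbf j}\}\Big)\le\prod_{\mathbf j\in J}P(X_{\mathbf j}\le x_{\mathbf j}),\qquad P\Big(\bigcap_{\mathbf j\in J}\{X_{\mathbf j}>x_{\mathbf j}\}\Big)\le\prod_{\mathbf j\in J}P(X_{\mathbf j}>x_{\mathbf j}).$$ Assume also that it is weakly mean bounded by a random variable $\xi$ (possibly on another probability space): with constants $\kappa_1,\kappa_2>0$, $\mathbf n_0\in\mathbb N^d$, $x_0\ge 0$, for all $x>x_0$ and all $\mathbf n\ge\mathbf n_0$, $$\kappa_2P(|\xi|>x)\le\frac1{|\mathbf n|}\sum_{\mathbf k\le\mathbf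 n}P(|X_{\mathbf k}|>x)\le\kappa_1P(|\xi|>x).$$ Let $r\ge2$, $\tfrac12=\alpha_1\le\alpha_2\le\dots\le\alpha_d$, $p=\max\{k:\alpha_k=\alpha_1\}$, $\log_+x=\max(1,\log x)$, and $$a_{\mathbf n}=\sqrt{\prod_{i=1}^pn_i\,\log\Big(\prod_{i=1}^pn_i\Big)}\ \prod_{i=p+1}^dn_i^{\alpha_i}.$$ The sums below extend over all $\mathbf n\in\mathbb N^d$ with $n_1\cdots n_p\ne1$, that is, with $a_{\mathbf n}\neq0$. (1) If $E\xi^2=\sigma^2<\infty$ and $E|\xi|^r(\log_+|\xi|)^{p-1-r/2}<\infty$, then $$\sum_{\mathbf n}|\mathbf n|^{r/2-2}P(|S_{\mathbf n}|\ge\varepsilon a_{\mathbf n})<\infty\qquad\text{for every }\varepsilon>\sigma_1\sqrt{r-2},\quad\text{where }\sigma_1^2=|\mathbf n_0|\,(\kappa_1\sigma^2+x_0^2).$$ In particular $\sigma_1^2=\kappa_1\sigma^2$ if the tail bounds hold for all $x>0$ and all $\mathbf n$ (that is, $x_0=0$, $\mathbf n_0=(1,\dots,1)$). (2) Conversely,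 suppose that either $r=2$ and $p\ge2$, or $r>2$. If $$\sum_{\mathbf n}|\mathbf n|^{r/2-2}P\Big(\max_{\mathbf k\le\mathbf n}|S_{\mathbf k}|\ge\varepsilon a_{\mathbf n}\Big)<\infty\qquad\text{for some }\varepsilon>0,$$ then $E|\xi|^r(\log_+|\xi|)^{p-1-r/2}<\infty$. -/

import Mathlib

open MeasureTheory Finset

noncomputable section

/-- The convention `log₊ x = max (1, log x)`. -/
def logPlus (x : ℝ) : ℝ := max 1 (Real.log x)

/-- `|n| = n₁ ⋯ n_d`, for a lattice point `n` with positive integer coordinates. -/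
def latticeSize {d : ℕ} (n : Fin d → ℕ+) : ℝ := ∏ i, (n i : ℝ)

/-- `n₁ ⋯ n_p` (the coordinate number `k` has the index `k - 1` in `Fin d`). -/
def headProd {d : ℕ} (p : ℕ) (n : Fin d → ℕ+) : ℝ :=
  ∏ i : Fin d with i.val < p, (n i : ℝ)

/-- The norming `√(n₁ ⋯ n_p · log (n₁ ⋯ n_p)) · n_{p+1}^{α_{p+1}} ⋯ n_d^{α_d}`. -/
def logNorming {d : ℕ} (p : ℕ) (α : Fin d → ℝ) (n : Fin d → ℕ+) : ℝ :=
  Real.sqrt (headProd p n * Real.log (headProd p n)) *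
    ∏ i : Fin d with p ≤ i.val, (n i : ℝ) ^ α i

/-- The partial sum `S_n = ∑_{k ≤ n} X_k`, for the coordinatewise order. -/
def partialSum {d : ℕ} {Ω : Type*} (X : (Fin d → ℕ+) → Ω → ℝ) (n : Fin d → ℕ+) (ω : Ω) : ℝ :=
  ∑ k ∈ Finset.Iic n, X k ω

/-- `max_{k ≤ n} |S_k|`. -/
def maxAbsPartialSum {d : ℕ} {Ω : Type*} (X : (Fin d → ℕ+) → Ω → ℝ) (n : Fin d → ℕ+) (ω : Ω) :
    ℝ :=
  (Finset.Iic n).sup' ⟨n, Finset.mem_Iic.2 le_rfl⟩ (fun k => |partialSum X k ω|)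

/-- Negative dependence of a family of random variables: both orthant inequalities hold for every
finite subfamily. -/
def NegativelyDependent {ι Ω : Type*} [MeasurableSpace Ω] (X : ι → Ω → ℝ) (P : Measure Ω) : Prop :=
  ∀ (s : Finset ι) (x : ι → ℝ),
    P.real {ω | ∀ j ∈ s, X j ω ≤ x j} ≤ ∏ j ∈ s, P.real {ω | X j ω ≤ x j} ∧
    P.real {ω | ∀ j ∈ s, x j < X j ω} ≤ ∏ j ∈ s, P.real {ω | x j < X j ω}

/-- The field `X` is weakly mean bounded by `ξ`, with the constants `κ₁`, `κ₂` and the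
thresholds `n₀`, `x₀`. -/
structure WeaklyMeanBounded {d : ℕ} {Ω Ω' : Type*} [MeasurableSpace Ω] [MeasurableSpace Ω']
    (X : (Fin d → ℕ+) → Ω → ℝ) (P : Measure Ω) (ξ : Ω' → ℝ) (Q : Measure Ω')
    (κ₁ κ₂ : ℝ) (n₀ : Fin d → ℕ+) (x₀ : ℝ) : Prop where
  pos_left : 0 < κ₁
  pos_right : 0 < κ₂
  threshold_nonneg : 0 ≤ x₀
  lower : ∀ x, x₀ < x → ∀ n, n₀ ≤ n →
    κ₂ * Q.real {ω | x < |ξ ω|} ≤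
      (1 / latticeSize n) * ∑ k ∈ Finset.Iic n, P.real {ω | x < |X k ω|}
  upper : ∀ x, x₀ < x → ∀ n, n₀ ≤ n →
    (1 / latticeSize n) * ∑ k ∈ Finset.Iic n, P.real {ω | x < |X k ω|} ≤
      κ₁ * Q.real {ω | x < |ξ ω|}

/-- `σ₁² = |n₀| (κ₁ σ² + x₀²)`; this is `κ₁ σ²` if the tail bounds hold for all `x > 0` and
all `n`, that is, for `x₀ = 0` and `n₀ = (1, …, 1)`. -/
def sigmaOneSq {d : ℕ} (κ₁ : ℝ) (n₀ : Fin d → ℕ+) (x₀ σ : ℝ) : ℝ :=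
  latticeSize n₀ * (κ₁ * σ ^ 2 + x₀ ^ 2)

/-- `E |ξ|^r (log₊ |ξ|)^{p - 1 - r/2} < ∞`. -/
def LogMomentFinite {Ω' : Type*} [MeasurableSpace Ω'] (ξ : Ω' → ℝ) (Q : Measure Ω')
    (r : ℝ) (p : ℕ) : Prop :=
  Integrable (fun ω => |ξ ω| ^ r * logPlus |ξ ω| ^ ((p : ℝ) - 1 - r / 2)) Q

end

noncomputable section

open Filter Topology
open scoped ENNReal

/-! Write `N = |n|`, `L = log N`, `a` for the norming at `n`, `σ₁²` for `sigmaOneSq`.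

Direct half. Since `x ↦ exp (t * min x y)` is increasing, the upper orthant inequality bounds the
expectation of a product of such factors by the product of the expectations. Markov's inequality
then gives a Fuk–Nagaev bound (`NegativelyDependent.measureReal_le_sum_le`) with two levels: `y`
truncates the variables, and `b` separates the values treated by a second order Taylor bound from
those treated crudely. Weak mean boundedness replaces the sums over `k ≤ n` by `N` times quantities
of `ξ`. Up to finitely many points, `a² ≥ N L`. For `r > 2`, taking `t` proportional to `L / a`
gives an exponential term of order `N ^ (-θ)` with `θ > (r - 2) / 2`; this is where the threshold
for `ε` enters. For `r = 2`, a `t` proportional to `log L / a` gives `L ^ (-2d)`, and any `ε > 0`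
will do. Both terms are summable with their weights.

What remains is the sum of `N ^ (r/2 - 1) * P(|ξ| > δ a)`. By Tonelli it is the expectation of a
weighted count of the points with `a` below a multiple of `|ξ|`. That count is at most of order `x ^
r * (log₊ x) ^ (p - 1 - r/2)` (`exists_count_le`): tail coordinates give convergent series, the
first head coordinate gives the power of `x² / log₊ x`, and each of the other `p - 1` head
coordinates gives a harmonic sum, hence a logarithm.

Converse half. Each `X k` is an alternating sum of at most `2 ^ d` partial sums, so a large `|X k|`
forces a large maximum of `|S k|`. Negative dependence makes the probability of some large `|X k|`
comparable from below to `min 1 (∑ P(|X k| > y))`, hence to `min 1` of a multiple of `N * P(|ξ| >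
y)`. Keeping only points whose tail is that of `n₀` gives a series over the `p`-dimensional head
lattice. The minimum with 1 is removed by monotonicity of the tail (`summable_of_summable_min`), and
a matching lower bound for the count (`exists_le_count`) returns the moment. -/

/-! ### From orthant inequalities to products of expectations; an exponential inequality -/

/-- The layer cake formula at a single point. -/
theorem ofReal_eq_lintegral_indicator (u : ℝ) :
    ENNReal.ofReal u = ∫⁻ z in Set.Ioi (0 : ℝ), (Set.Iio u).indicator 1 z := by
  rw [lintegral_indicator_one measurableSet_Iio, Measure.restrict_apply measurableSet_Iio,
    Set.inter_comm, Set.Ioi_inter_Iio, Real.volume_Ioo, sub_zero]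

/-- If the upper orthant inequality holds for the family `Z` at positive levels, then so does the
product inequality for the expectations of the positive parts. -/
theorem lintegral_prod_ofReal_le {ι Ω : Type*} [DecidableEq ι] [MeasurableSpace Ω] (P : Measure Ω)
    [SFinite P] (Z : ι → Ω → ℝ) (hZ : ∀ j, Measurable (Z j))
    (h : ∀ (s : Finset ι) (z : ι → ℝ), (∀ j, 0 < z j) →
      P {ω | ∀ j ∈ s, z j < Z j ω} ≤ ∏ j ∈ s, P {ω | z j < Z j ω}) (A : Finset ι) :
    ∀ (B : Finset ι), Disjoint A B → ∀ z : ι → ℝ, (∀ j, 0 < z j) →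
      ∫⁻ ω, (∏ j ∈ A, ENNReal.ofReal (Z j ω)) * {ω | ∀ j ∈ B, z j < Z j ω}.indicator 1 ω ∂P ≤
        (∏ j ∈ A, ∫⁻ ω, ENNReal.ofReal (Z j ω) ∂P) * ∏ j ∈ B, P {ω | z j < Z j ω} := by
  have hset : ∀ (B : Finset ι) (z : ι → ℝ), MeasurableSet {ω | ∀ j ∈ B, z j < Z j ω} := by
    intro B z
    have : {ω | ∀ j ∈ B, z j < Z j ω} = ⋂ j ∈ B, {ω | z j < Z j ω} := by ext; simp
    rw [this]
    exact Finset.measurableSet_biInter _ fun j _ => measurableSet_lt measurable_const (hZ j)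
  induction A using Finset.induction_on with
  | empty =>
    intro B _ z hz
    simpa [lintegral_indicator_one (hset B z)] using h B z hz
  | insert a A haA ih =>
    intro B hd z hz
    rw [Finset.disjoint_insert_left] at hd
    have hG : Measurable fun ω => (∏ j ∈ A, ENNReal.ofReal (Z j ω)) *
        {ω | ∀ j ∈ B, z j < Z j ω}.indicator (1 : Ω → ℝ≥0∞) ω :=
      (Finset.measurable_prod _ fun j _ => (hZ j).ennreal_ofReal).mul
        (measurable_one.indicator (hset B z))
    have hI : Measurable fun q : Ω × ℝ => (Set.Iio (Z a q.1)).indicator (1 : ℝ → ℝ≥0∞) q.2 := by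
      have : (fun q : Ω × ℝ => (Set.Iio (Z a q.1)).indicator (1 : ℝ → ℝ≥0∞) q.2) =
          {q : Ω × ℝ | q.2 < Z a q.1}.indicator 1 := by
        ext q; simp [Set.indicator]
      rw [this]
      exact measurable_one.indicator
        (measurableSet_lt measurable_snd ((hZ a).comp measurable_fst))
    -- The layer cake turns the factor of `a` into indicators of `t < Z a`. Under the integral in
    -- `t`, the index `a` thus moves from `A` to `B` with level `t`, which is why the induction
    -- hypothesis has to range over all `B` and `z`.
    calc _ = ∫⁻ ω : Ω, (∫⁻ t : ℝ in Set.Ioi (0 : ℝ), (Set.Iio (Z a ω)).indicator 1 t *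
          ((∏ j ∈ A, ENNReal.ofReal (Z j ω)) * {ω | ∀ j ∈ B, z j < Z j ω}.indicator 1 ω)) ∂P := by
          refine lintegral_congr fun ω => ?_
          rw [lintegral_mul_const _ (measurable_one.indicator measurableSet_Iio),
            ← ofReal_eq_lintegral_indicator, Finset.prod_insert haA, mul_assoc]
      _ = ∫⁻ t : ℝ in Set.Ioi (0 : ℝ), ∫⁻ ω : Ω, (Set.Iio (Z a ω)).indicator 1 t *
          ((∏ j ∈ A, ENNReal.ofReal (Z j ω)) *
            {ω | ∀ j ∈ B, z j < Z j ω}.indicator 1 ω) ∂P := by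
          rw [lintegral_lintegral_swap]
          exact (hI.mul (hG.comp measurable_fst)).aemeasurable
      _ ≤ ∫⁻ t in Set.Ioi (0 : ℝ), P {ω | t < Z a ω} *
          ((∏ j ∈ A, ∫⁻ ω, ENNReal.ofReal (Z j ω) ∂P) * ∏ j ∈ B, P {ω | z j < Z j ω}) := by
          refine setLIntegral_mono' measurableSet_Ioi fun t ht => ?_
          have hne : ∀ j ∈ B, j ≠ a := fun j hj e => hd.1 (e ▸ hj)
          have := ih (insert a B) (Finset.disjoint_insert_right.2 ⟨haA, hd.2⟩)
            (Function.update z a t) (fun j => by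
              by_cases hj : j = a
              · subst hj; simpa using ht
              · simpa [hj] using hz j)
          have hB : ∏ j ∈ B, P {ω | Function.update z a t j < Z j ω} =
              ∏ j ∈ B, P {ω | z j < Z j ω} :=
            Finset.prod_congr rfl fun j hj => by rw [Function.update_of_ne (hne j hj)]
          rw [Finset.prod_insert hd.1, Function.update_self, hB] at this
          refine le_trans (le_of_eq ?_) (this.trans (le_of_eq (by ring)))
          refine lintegral_congr fun ω => ?_
          have : (∀ j ∈ insert a B, Function.update z a t j < Z j ω) ↔
              t < Z a ω ∧ ∀ j ∈ B, z j < Z j ω := by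
            rw [Finset.forall_mem_insert, Function.update_self]
            refine and_congr_right fun _ => forall₂_congr fun j hj => ?_
            rw [Function.update_of_ne (hne j hj)]
          simp only [Set.indicator, Set.mem_ofPred_eq, this, Set.mem_Iio]
          by_cases h1 : t < Z a ω <;> by_cases h2 : ∀ j ∈ B, z j < Z j ω <;> simp [h1, h2]
      _ = _ := by
          have e : ∫⁻ t in Set.Ioi (0 : ℝ), P {ω | t < Z a ω} =
              ∫⁻ ω, ENNReal.ofReal (Z a ω) ∂P := by
            simp_rw [ofReal_eq_lintegral_indicator (Z a _)]
            rw [lintegral_lintegral_swap hI.aemeasurable]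
            refine lintegral_congr fun t => ?_
            rw [← lintegral_indicator_one (measurableSet_lt measurable_const (hZ a))]
            rfl
          have hanti : Antitone fun t : ℝ => P {ω | t < Z a ω} := fun t t' htt =>
            measure_mono fun ω (hω : t' < Z a ω) => htt.trans_lt hω
          rw [lintegral_mul_const _ hanti.measurable, e, Finset.prod_insert haA]
          ring

/-- For `u ≤ 0` the Taylor remainder is at most `u ^ 2 / 2`; for `u ≥ 0` it is at most `u ^ 2 / 2 *
exp u`. After division by the exponential, each claim compares a monotone function with its value at
0. -/
theorem exp_le_one_add_add_sq_mul_exp {u c : ℝ} (huc : u ≤ c) (hc : 0 ≤ c) :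
    Real.exp u ≤ 1 + u + u ^ 2 / 2 * Real.exp c := by
  rcases le_total u 0 with hu | hu
  · have hanti : Antitone fun v : ℝ => (1 + v + v ^ 2 / 2) * Real.exp (-v) := by
      have hd : ∀ v : ℝ, HasDerivAt (fun v : ℝ => (1 + v + v ^ 2 / 2) * Real.exp (-v))
          (-(v ^ 2 / 2 * Real.exp (-v))) v := by
        intro v
        have h1 : HasDerivAt (fun v : ℝ => 1 + v + v ^ 2 / 2) (1 + v) v :=
          (((hasDerivAt_id' v).const_add 1).add ((hasDerivAt_pow 2 v).div_const 2)).congr_deriv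
            (by norm_num)
        have h2 : HasDerivAt (fun v : ℝ => Real.exp (-v)) (Real.exp (-v) * -1) v :=
          (hasDerivAt_neg v).exp
        exact (h1.mul h2).congr_deriv (by ring)
      refine antitone_of_deriv_nonpos (fun v => (hd v).differentiableAt) fun v => ?_
      rw [(hd v).deriv]
      have := Real.exp_pos (-v)
      nlinarith [mul_nonneg (sq_nonneg v) this.le]
    have h1 := hanti hu
    simp only [neg_zero, Real.exp_zero] at h1
    have h2 : Real.exp u ≤ 1 + u + u ^ 2 / 2 := by
      have := mul_le_mul_of_nonneg_right h1 (Real.exp_pos u).le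
      rw [mul_assoc _ (Real.exp (-u)), ← Real.exp_add] at this
      simpa using this
    nlinarith [Real.one_le_exp hc, sq_nonneg u]
  · have hmono : MonotoneOn (fun v : ℝ => (1 + v) * Real.exp (-v) + v ^ 2 / 2) (Set.Ici 0) := by
      have hd : ∀ v : ℝ, HasDerivAt (fun v : ℝ => (1 + v) * Real.exp (-v) + v ^ 2 / 2)
          (v * (1 - Real.exp (-v))) v := by
        intro v
        have h1 : HasDerivAt (fun v : ℝ => v ^ 2 / 2) v v :=
          ((hasDerivAt_pow 2 v).div_const 2).congr_deriv (by norm_num)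
        have h2 : HasDerivAt (fun v : ℝ => Real.exp (-v)) (Real.exp (-v) * -1) v :=
          (hasDerivAt_neg v).exp
        exact ((((hasDerivAt_id' v).const_add 1).mul h2).add h1).congr_deriv (by ring)
      refine monotoneOn_of_deriv_nonneg (convex_Ici 0)
        (fun v _ => (hd v).continuousAt.continuousWithinAt)
        (fun v _ => (hd v).differentiableAt.differentiableWithinAt) fun v hv => ?_
      rw [interior_Ici] at hv
      rw [(hd v).deriv]
      have : Real.exp (-v) ≤ 1 := Real.exp_le_one_iff.2 (by simpa using (le_of_lt hv))
      exact mul_nonneg (le_of_lt hv) (by linarith)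
    have h1 := hmono (Set.mem_Ici.2 le_rfl) (Set.mem_Ici.2 hu) hu
    simp only [neg_zero, Real.exp_zero] at h1
    have h2 : Real.exp u ≤ 1 + u + u ^ 2 / 2 * Real.exp u := by
      have := mul_le_mul_of_nonneg_right h1 (Real.exp_pos u).le
      rw [add_mul _ (u ^ 2 / 2) (Real.exp u), mul_assoc _ (Real.exp (-u)),
        ← Real.exp_add] at this
      simpa using this
    nlinarith [Real.exp_le_exp.2 huc, sq_nonneg u]

/-! ### Negative dependence: upper bounds for sums, lower bounds for maxima -/

section ND

variable {ι Ω : Type*} [MeasurableSpace Ω] {X : ι → Ω → ℝ} {P : Measure Ω}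

/-- The sign change exchanges the two orthants but also strict and non-strict inequalities. Shifting
the levels by `1 / (n + 1)` and using continuity of the measure repairs this. -/
theorem NegativelyDependent.neg [IsProbabilityMeasure P] (h : NegativelyDependent X P)
    (hX : ∀ j, Measurable (X j)) : NegativelyDependent (fun j ω => -X j ω) P := by
  intro s x
  have hd : Tendsto (fun n : ℕ => 1 / ((n : ℝ) + 1)) atTop (𝓝 0) :=
    tendsto_one_div_add_atTop_nhds_zero_nat
  have hda : ∀ m n : ℕ, m ≤ n → 1 / ((n : ℝ) + 1) ≤ 1 / ((m : ℝ) + 1) := fun m n hmn =>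
    one_div_le_one_div_of_le (by positivity) (by exact_mod_cast Nat.succ_le_succ hmn)
  constructor
  · have hlim : ∀ j, Tendsto (fun n : ℕ => P.real {ω | -x j - 1 / ((n : ℝ) + 1) < X j ω}) atTop
        (𝓝 (P.real {ω | -X j ω ≤ x j})) := by
      intro j
      have hset : {ω | -X j ω ≤ x j} = ⋂ n : ℕ, {ω | -x j - 1 / ((n : ℝ) + 1) < X j ω} := by
        ext ω
        simp only [Set.mem_ofPred_eq, Set.mem_iInter]
        constructor
        · intro hω n
          have : 0 < 1 / ((n : ℝ) + 1) := by positivity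
          linarith
        · intro hω
          have := le_of_tendsto' (hd.const_sub (-x j)) (fun n => (hω n).le)
          simp at this
          linarith
      rw [hset]
      refine (ENNReal.tendsto_toReal (measure_ne_top _ _)).comp
        (tendsto_measure_iInter_atTop
          (fun n => (measurableSet_lt measurable_const (hX j)).nullMeasurableSet) ?_
          ⟨0, measure_ne_top _ _⟩)
      intro m n hmn ω hω
      have := hda m n hmn
      simp only [Set.mem_ofPred_eq] at hω ⊢
      linarith
    refine ge_of_tendsto' (tendsto_finsetProd s fun j _ => hlim j) fun n => ?_
    refine le_trans (measureReal_mono ?_) (h s fun j => -x j - 1 / ((n : ℝ) + 1)).2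
    intro ω hω j hj
    have := hω j hj
    have : 0 < 1 / ((n : ℝ) + 1) := by positivity
    linarith
  · have hlim : Tendsto (fun n : ℕ => P.real {ω | ∀ j ∈ s, X j ω ≤ -x j - 1 / ((n : ℝ) + 1)})
        atTop (𝓝 (P.real {ω | ∀ j ∈ s, x j < -X j ω})) := by
      have hset : {ω | ∀ j ∈ s, x j < -X j ω} =
          ⋃ n : ℕ, {ω | ∀ j ∈ s, X j ω ≤ -x j - 1 / ((n : ℝ) + 1)} := by
        ext ω
        simp only [Set.mem_ofPred_eq, Set.mem_iUnion]
        constructor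
        · intro hω
          have : ∀ᶠ n : ℕ in atTop, ∀ j ∈ s, X j ω ≤ -x j - 1 / ((n : ℝ) + 1) := by
            rw [Filter.eventually_all_finset]
            intro j hj
            have hpos : 0 < -x j - X j ω := by linarith [hω j hj]
            filter_upwards [hd.eventually_lt_const hpos] with n hn
            linarith
          exact this.exists
        · rintro ⟨n, hn⟩ j hj
          have := hn j hj
          have : 0 < 1 / ((n : ℝ) + 1) := by positivity
          linarith
      rw [hset]
      refine (ENNReal.tendsto_toReal (measure_ne_top _ _)).comp
        (tendsto_measure_iUnion_atTop ?_)
      intro m n hmn ω hω j hj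
      have := hda m n hmn
      have := hω j hj
      linarith
    refine le_of_tendsto' hlim fun n => ?_
    refine (h s fun j => -x j - 1 / ((n : ℝ) + 1)).1.trans ?_
    refine Finset.prod_le_prod (fun _ _ => measureReal_nonneg) fun j _ => measureReal_mono ?_
    intro ω hω
    have : 0 < 1 / ((n : ℝ) + 1) := by positivity
    simp only [Set.mem_ofPred_eq] at hω ⊢
    linarith

/-- By monotonicity, a superlevel set of `exp (t * min X y)` is either a superlevel set of `X` or,
for levels not below `exp (t * y)`, empty. So the upper orthant inequality survives the truncation.
-/
theorem NegativelyDependent.lintegral_prod_exp_min_le [DecidableEq ι] [IsProbabilityMeasure P]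
    (h : NegativelyDependent X P) (hX : ∀ j, Measurable (X j)) {t : ℝ} (ht : 0 < t) (y : ℝ)
    (s : Finset ι) :
    ∫⁻ ω, ∏ j ∈ s, ENNReal.ofReal (Real.exp (t * min (X j ω) y)) ∂P ≤
      ∏ j ∈ s, ∫⁻ ω, ENNReal.ofReal (Real.exp (t * min (X j ω) y)) ∂P := by
  have key := lintegral_prod_ofReal_le P (fun j ω => Real.exp (t * min (X j ω) y))
    (fun j => (((hX j).min measurable_const).const_mul t).exp) ?_ s ∅ (by simp) (fun _ => 1)
    (by simp)
  · simpa using key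
  intro s z hz
  have hiff : ∀ j ω, z j < Real.exp (t * min (X j ω) y) ↔
      Real.log (z j) / t < X j ω ∧ z j < Real.exp (t * y) := by
    intro j ω
    rw [← Real.log_lt_iff_lt_exp (hz j), ← Real.log_lt_iff_lt_exp (hz j), div_lt_iff₀' ht,
      mul_min_of_nonneg _ _ ht.le, lt_min_iff]
  by_cases hs : ∀ j ∈ s, z j < Real.exp (t * y)
  · have h2 := (h s fun j => Real.log (z j) / t).2
    simp only [measureReal_def] at h2
    rw [← ENNReal.toReal_prod, ENNReal.toReal_le_toReal (measure_ne_top _ _)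
      (ENNReal.prod_ne_top fun _ _ => measure_ne_top _ _)] at h2
    convert h2 using 1
    · congr 1
      ext ω
      exact forall₂_congr fun j hj => by simp [hiff, hs j hj]
    · refine Finset.prod_congr rfl fun j hj => ?_
      congr 1
      ext ω
      simp [hiff, hs j hj]
  · push Not at hs
    obtain ⟨j, hj, hjz⟩ := hs
    have : {ω | ∀ j ∈ s, z j < Real.exp (t * min (X j ω) y)} = ∅ := by
      ext ω
      simp only [Set.mem_ofPred_eq, Set.mem_empty_iff_false, iff_false]
      exact fun hω => absurd ((hiff j ω).1 (hω j hj)).2 (not_lt.2 hjz)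
    rw [this, measure_empty]
    exact zero_le

/-- The large factor `exp (t * y)` is paid only where `x > b`. Elsewhere the second order term
carries only `exp (t * b)`, which is what preserves the sharp constant for `r > 2`. -/
theorem exp_mul_min_le {x y b t : ℝ} (ht : 0 ≤ t) (hb : 0 ≤ b) (hy : 0 ≤ y) :
    Real.exp (t * min x y) ≤ 1 + t * min x y + t ^ 2 / 2 * Real.exp (t * b) * x ^ 2 +
      Real.exp (t * y) * (Set.Ioi b).indicator 1 x := by
  by_cases hx : b < x
  · have h0 : 0 ≤ min x y := le_min (hb.trans hx.le) hy
    have h1 : Real.exp (t * min x y) ≤ Real.exp (t * y) :=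
      Real.exp_le_exp.2 (mul_le_mul_of_nonneg_left (min_le_right _ _) ht)
    have h2 : (Set.Ioi b).indicator (1 : ℝ → ℝ) x = 1 := by simp [hx]
    rw [h2]
    have : 0 ≤ t ^ 2 / 2 * Real.exp (t * b) * x ^ 2 := by positivity
    have := mul_nonneg ht h0
    linarith
  · have h2 : (Set.Ioi b).indicator (1 : ℝ → ℝ) x = 0 := by simp [not_lt.1 hx]
    rw [h2, mul_zero, add_zero]
    have h1 := exp_le_one_add_add_sq_mul_exp (u := t * min x y) (c := t * b)
      (mul_le_mul_of_nonneg_left ((min_le_left _ _).trans (not_lt.1 hx)) ht) (by positivity)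
    refine h1.trans ?_
    have h3 : (min x y) ^ 2 ≤ x ^ 2 := by
      rcases le_total x y with h | h
      · rw [min_eq_left h]
      · rw [min_eq_right h]
        nlinarith
    have h4 : 0 ≤ t ^ 2 / 2 * Real.exp (t * b) := by positivity
    nlinarith [mul_le_mul_of_nonneg_left h3 h4]

/-- Truncation from above only lowers the mean, so the linear term is nonpositive and drops out;
then `1 + v ≤ exp v`. -/
theorem integral_exp_mul_min_le [IsProbabilityMeasure P] {Y : Ω → ℝ} (hY : Measurable Y)
    (hint : Integrable Y P) (hmean : ∫ ω, Y ω ∂P = 0) (hsq : Integrable (fun ω => Y ω ^ 2) P)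
    {t b y : ℝ} (ht : 0 ≤ t) (hb : 0 ≤ b) (hy : 0 ≤ y) :
    ∫⁻ ω, ENNReal.ofReal (Real.exp (t * min (Y ω) y)) ∂P ≤
      ENNReal.ofReal (Real.exp (t ^ 2 / 2 * Real.exp (t * b) * ∫ ω, Y ω ^ 2 ∂P +
        Real.exp (t * y) * P.real {ω | b < Y ω})) := by
  have hmin : Integrable (fun ω => min (Y ω) y) P := hint.inf (integrable_const y)
  have hind : (fun ω => (Set.Ioi b).indicator (1 : ℝ → ℝ) (Y ω)) =
      {ω | b < Y ω}.indicator 1 := by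
    ext ω; simp [Set.indicator]
  have hI : Integrable (fun ω => (Set.Ioi b).indicator (1 : ℝ → ℝ) (Y ω)) P := by
    rw [hind]
    exact (integrable_const 1).indicator (measurableSet_lt measurable_const hY)
  have i1 : Integrable (fun ω => 1 + t * min (Y ω) y) P :=
    (integrable_const 1).add (hmin.const_mul t)
  have i2 : Integrable (fun ω => t ^ 2 / 2 * Real.exp (t * b) * Y ω ^ 2) P := hsq.const_mul _
  have i3 : Integrable (fun ω => Real.exp (t * y) * (Set.Ioi b).indicator (1 : ℝ → ℝ) (Y ω)) P :=
    hI.const_mul _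
  calc _ ≤ ∫⁻ ω, ENNReal.ofReal (1 + t * min (Y ω) y + t ^ 2 / 2 * Real.exp (t * b) * Y ω ^ 2 +
        Real.exp (t * y) * (Set.Ioi b).indicator 1 (Y ω)) ∂P :=
        lintegral_mono fun ω => ENNReal.ofReal_le_ofReal (exp_mul_min_le ht hb hy)
    _ = ENNReal.ofReal (∫ ω, (1 + t * min (Y ω) y + t ^ 2 / 2 * Real.exp (t * b) * Y ω ^ 2 +
        Real.exp (t * y) * (Set.Ioi b).indicator 1 (Y ω)) ∂P) :=
        (ofReal_integral_eq_lintegral_ofReal ((i1.add i2).add i3)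
          (Eventually.of_forall fun ω => (Real.exp_pos _).le.trans
            (exp_mul_min_le ht hb hy))).symm
    _ ≤ _ := by
      refine ENNReal.ofReal_le_ofReal ?_
      have e1 : ∫ ω, (1 + t * min (Y ω) y + t ^ 2 / 2 * Real.exp (t * b) * Y ω ^ 2 +
          Real.exp (t * y) * (Set.Ioi b).indicator 1 (Y ω)) ∂P =
          1 + t * ∫ ω, min (Y ω) y ∂P + t ^ 2 / 2 * Real.exp (t * b) * ∫ ω, Y ω ^ 2 ∂P +
          Real.exp (t * y) * P.real {ω | b < Y ω} := by
        have i12 : Integrable (fun ω => 1 + t * min (Y ω) y +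
            t ^ 2 / 2 * Real.exp (t * b) * Y ω ^ 2) P := i1.add i2
        rw [integral_add i12 i3, integral_add i1 i2,
          integral_add (integrable_const 1) (hmin.const_mul t), integral_const_mul,
          integral_const_mul, integral_const_mul, hind,
          integral_indicator_one (measurableSet_lt measurable_const hY)]
        simp
      have e2 : ∫ ω, min (Y ω) y ∂P ≤ 0 := by
        rw [← hmean]
        exact integral_mono hmin hint fun ω => min_le_left _ _
      rw [e1]
      refine le_trans ?_ (Real.add_one_le_exp _)
      nlinarith [mul_nonneg ht (neg_nonneg.2 e2)]

/-- An exponential inequality of Fuk–Nagaev type with two truncation levels. -/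
theorem NegativelyDependent.measureReal_le_sum_le [DecidableEq ι] [IsProbabilityMeasure P]
    (h : NegativelyDependent X P) (hX : ∀ j, Measurable (X j)) (hint : ∀ j, Integrable (X j) P)
    (hmean : ∀ j, ∫ ω, X j ω ∂P = 0) (hsq : ∀ j, Integrable (fun ω => X j ω ^ 2) P)
    {t b y : ℝ} (ht : 0 < t) (hb : 0 ≤ b) (hy : 0 ≤ y) (x : ℝ) (s : Finset ι) :
    P.real {ω | x ≤ ∑ j ∈ s, X j ω} ≤ ∑ j ∈ s, P.real {ω | y < X j ω} +
      Real.exp (-(t * x) + (t ^ 2 / 2 * Real.exp (t * b) * ∑ j ∈ s, ∫ ω, X j ω ^ 2 ∂P +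
        Real.exp (t * y) * ∑ j ∈ s, P.real {ω | b < X j ω})) := by
  have hsub : {ω | x ≤ ∑ j ∈ s, X j ω} ⊆ (⋃ j ∈ s, {ω | y < X j ω}) ∪
      {ω | x ≤ ∑ j ∈ s, min (X j ω) y} := by
    intro ω hω
    by_cases hj : ∃ j ∈ s, y < X j ω
    · left; simpa using hj
    · right
      push Not at hj
      simp only [Set.mem_ofPred_eq] at hω ⊢
      rwa [Finset.sum_congr rfl fun j hjs => min_eq_left (hj j hjs)]
  refine (measureReal_mono hsub).trans ((measureReal_union_le _ _).trans
    (add_le_add (measureReal_biUnion_finset_le _ _) ?_))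
  set E : ℝ := t ^ 2 / 2 * Real.exp (t * b) * ∑ j ∈ s, ∫ ω, X j ω ^ 2 ∂P +
        Real.exp (t * y) * ∑ j ∈ s, P.real {ω | b < X j ω} with hE
  have hmeas : Measurable fun ω => ∏ j ∈ s, ENNReal.ofReal (Real.exp (t * min (X j ω) y)) :=
    Finset.measurable_prod _ fun j _ =>
      (((hX j).min measurable_const).const_mul t).exp.ennreal_ofReal
  have h1 : ENNReal.ofReal (Real.exp (t * x)) * P {ω | x ≤ ∑ j ∈ s, min (X j ω) y} ≤
      ENNReal.ofReal (Real.exp E) := by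
    calc _ ≤ ENNReal.ofReal (Real.exp (t * x)) * P {ω | ENNReal.ofReal (Real.exp (t * x)) ≤
            ∏ j ∈ s, ENNReal.ofReal (Real.exp (t * min (X j ω) y))} := by
          gcongr with ω
          intro hω
          rw [← ENNReal.ofReal_prod_of_nonneg fun _ _ => (Real.exp_pos _).le, ← Real.exp_sum,
            ← Finset.mul_sum]
          exact ENNReal.ofReal_le_ofReal (Real.exp_le_exp.2 (mul_le_mul_of_nonneg_left hω ht.le))
      _ ≤ ∫⁻ ω, ∏ j ∈ s, ENNReal.ofReal (Real.exp (t * min (X j ω) y)) ∂P :=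
          mul_meas_ge_le_lintegral hmeas _
      _ ≤ ∏ j ∈ s, ∫⁻ ω, ENNReal.ofReal (Real.exp (t * min (X j ω) y)) ∂P :=
          h.lintegral_prod_exp_min_le hX ht y s
      _ ≤ ∏ j ∈ s, ENNReal.ofReal (Real.exp (t ^ 2 / 2 * Real.exp (t * b) * ∫ ω, X j ω ^ 2 ∂P +
            Real.exp (t * y) * P.real {ω | b < X j ω})) :=
          Finset.prod_le_prod' fun j _ =>
            integral_exp_mul_min_le (hX j) (hint j) (hmean j) (hsq j) ht.le hb hy
      _ = ENNReal.ofReal (Real.exp E) := by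
          rw [← ENNReal.ofReal_prod_of_nonneg fun _ _ => (Real.exp_pos _).le, ← Real.exp_sum,
            Finset.sum_add_distrib, ← Finset.mul_sum, ← Finset.mul_sum]
  have h2 := ENNReal.toReal_mono ENNReal.ofReal_ne_top h1
  rw [ENNReal.toReal_mul, ENNReal.toReal_ofReal (Real.exp_pos _).le,
    ENNReal.toReal_ofReal (Real.exp_pos _).le] at h2
  rw [Real.exp_add, Real.exp_neg, ← div_eq_inv_mul, le_div_iff₀' (Real.exp_pos _)]
  exact h2

/-- The lower orthant inequality bounds the probability that no variable exceeds `x` by a product of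
factors `1 - p_j ≤ exp (-p_j)`. -/
theorem NegativelyDependent.one_sub_exp_le [IsProbabilityMeasure P] (h : NegativelyDependent X P)
    (hX : ∀ j, Measurable (X j)) (x : ℝ) (s : Finset ι) :
    1 - Real.exp (-∑ j ∈ s, P.real {ω | x < X j ω}) ≤ P.real {ω | ∃ j ∈ s, x < X j ω} := by
  have hc : {ω | ∃ j ∈ s, x < X j ω} = {ω | ∀ j ∈ s, X j ω ≤ x}ᶜ := by
    ext ω; simp
  have hm : MeasurableSet {ω | ∀ j ∈ s, X j ω ≤ x} := by
    have : {ω | ∀ j ∈ s, X j ω ≤ x} = ⋂ j ∈ s, {ω | X j ω ≤ x} := by ext; simp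
    rw [this]
    exact Finset.measurableSet_biInter _ fun j _ => measurableSet_le (hX j) measurable_const
  rw [hc, probReal_compl_eq_one_sub hm]
  refine sub_le_sub_left ((h s fun _ => x).1.trans ?_) 1
  rw [← Finset.sum_neg_distrib, Real.exp_sum]
  refine Finset.prod_le_prod (fun _ _ => measureReal_nonneg) fun j _ => ?_
  have : {ω | X j ω ≤ x} = {ω | x < X j ω}ᶜ := by ext; simp
  rw [this, probReal_compl_eq_one_sub (measurableSet_lt measurable_const (hX j))]
  linarith [Real.add_one_le_exp (-P.real {ω | x < X j ω})]

/-- The probability that one of finitely many negatively dependent variables is large. -/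
theorem NegativelyDependent.min_one_sum_le [IsProbabilityMeasure P] (h : NegativelyDependent X P)
    (hX : ∀ j, Measurable (X j)) (x : ℝ) (s : Finset ι) :
    min 1 (∑ j ∈ s, P.real {ω | x < |X j ω|}) ≤ 4 * P.real {ω | ∃ j ∈ s, x < |X j ω|} := by
  -- The constant 4 is the 2 of this bound, taken once for `X` and once for `-X`.
  have aux : ∀ u : ℝ, 0 ≤ u → min 1 u ≤ 2 * (1 - Real.exp (-u)) := by
    intro u hu
    rcases le_total 1 u with h1 | h1
    · rw [min_eq_left h1]
      have h2 : Real.exp (-u) ≤ Real.exp (-1) := Real.exp_le_exp.2 (by linarith)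
      have h3 : Real.exp (-1) ≤ 1 / 2 := by
        rw [Real.exp_neg, ← one_div]
        exact one_div_le_one_div_of_le (by norm_num) (by linarith [Real.add_one_le_exp 1])
      linarith
    · rw [min_eq_right h1]
      have h2 : Real.exp (-u) * (1 + u) ≤ 1 := by
        have := mul_le_mul_of_nonneg_left (Real.add_one_le_exp u) (Real.exp_pos (-u)).le
        rw [← Real.exp_add] at this
        simpa [add_comm] using this
      have h3 : Real.exp (-u) ≤ 1 := Real.exp_le_one_iff.2 (by linarith)
      nlinarith [Real.exp_pos (-u)]
  have hp : ∀ Y : ι → Ω → ℝ, NegativelyDependent Y P → (∀ j, Measurable (Y j)) →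
      (∀ j ω, Y j ω ≤ |X j ω|) →
      min 1 (∑ j ∈ s, P.real {ω | x < Y j ω}) ≤ 2 * P.real {ω | ∃ j ∈ s, x < |X j ω|} := by
    intro Y hY hYm hYX
    refine (aux _ (Finset.sum_nonneg fun _ _ => measureReal_nonneg)).trans
      (mul_le_mul_of_nonneg_left ((hY.one_sub_exp_le hYm x s).trans (measureReal_mono ?_))
        (by norm_num))
    rintro ω ⟨j, hj, hjx⟩
    exact ⟨j, hj, hjx.trans_le (hYX j ω)⟩
  have h1 := hp X h hX fun j ω => le_abs_self _
  have h2 := hp _ (h.neg hX) (fun j => (hX j).neg) fun j ω => neg_le_abs _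
  have h3 : ∑ j ∈ s, P.real {ω | x < |X j ω|} ≤
      ∑ j ∈ s, P.real {ω | x < X j ω} + ∑ j ∈ s, P.real {ω | x < -X j ω} := by
    rw [← Finset.sum_add_distrib]
    refine Finset.sum_le_sum fun j _ => le_trans (measureReal_mono ?_) (measureReal_union_le _ _)
    intro ω hω
    simpa [lt_abs] using hω
  have h4 : ∀ u v w : ℝ, 0 ≤ u → 0 ≤ v → w ≤ u + v → min 1 w ≤ min 1 u + min 1 v := by
    intro u v w hu hv hw
    rcases le_total 1 u with a | a <;> rcases le_total 1 v with b | b <;>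
      rcases le_total 1 w with c | c <;> simp [a, b, c] <;> linarith
  have := h4 _ _ _ (Finset.sum_nonneg fun _ _ => measureReal_nonneg)
    (Finset.sum_nonneg fun _ _ => measureReal_nonneg) h3
  linarith

end ND

/-! ### Lattice points and rectangular increments -/

section Lattice

variable {d : ℕ}

theorem latticeSize_pos (n : Fin d → ℕ+) : 0 < latticeSize n :=
  Finset.prod_pos fun i _ => by exact_mod_cast (n i).pos

theorem one_le_latticeSize (n : Fin d → ℕ+) : 1 ≤ latticeSize n :=
  Finset.one_le_prod fun i _ => by exact_mod_cast (one_le (a := n i))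

theorem latticeSize_mul (m n : Fin d → ℕ+) :
    latticeSize (m * n) = latticeSize m * latticeSize n := by
  simp [latticeSize, Finset.prod_mul_distrib]

theorem latticeSize_eq_card (n : Fin d → ℕ+) : latticeSize n = ((Finset.Iic n).card : ℝ) := by
  have : Finset.Iic n = Fintype.piFinset fun i => Finset.Iic (n i) := by
    ext k; simp [Pi.le_def]
  rw [this, Fintype.card_piFinset, latticeSize, Nat.cast_prod]
  refine Finset.prod_congr rfl fun i _ => ?_
  have : Finset.Iic (n i) = Finset.Icc 1 (n i) := by ext k; simp
  rw [this, PNat.card_Icc]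
  simp

theorem le_latticeSize (n : Fin d → ℕ+) (i : Fin d) : (n i : ℝ) ≤ latticeSize n := by
  rw [latticeSize, ← Finset.mul_prod_erase _ _ (Finset.mem_univ i)]
  exact le_mul_of_one_le_right (by positivity)
    (Finset.one_le_prod fun j _ => Nat.one_le_cast.2 (PNat.pos (n j)))

theorem finite_latticeSize_lt (N : ℝ) : {n : Fin d → ℕ+ | latticeSize n < N}.Finite := by
  rcases le_or_gt N 0 with hN | hN
  · convert Set.finite_empty
    ext n
    simpa using hN.trans (latticeSize_pos n).le
  have : 0 < ⌈N⌉₊ := Nat.ceil_pos.2 hN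
  refine (Set.finite_Iic (fun _ : Fin d => (⟨⌈N⌉₊, this⟩ : ℕ+))).subset fun n hn i => ?_
  have h2 : (n i : ℝ) ≤ (⌈N⌉₊ : ℝ) := ((le_latticeSize n i).trans (le_of_lt hn)).trans (Nat.le_ceil N)
  have h3 : (n i : ℕ) ≤ ⌈N⌉₊ := by exact_mod_cast h2
  exact h3

/-- A rectangular increment of the partial sums in the directions `A`. -/
theorem abs_sum_filter_le {Ω : Type*} (X : (Fin d → ℕ+) → Ω → ℝ) (ω : Ω) (n : Fin d → ℕ+) {M : ℝ}
    (hM : ∀ j ≤ n, |partialSum X j ω| ≤ M) (A : Finset (Fin d)) :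
    ∀ k ≤ n, |∑ j ∈ (Finset.Iic k).filter fun j => ∀ i ∈ A, j i = k i, X j ω| ≤
      2 ^ A.card * M := by
  have hM0 : 0 ≤ M := (abs_nonneg _).trans (hM n le_rfl)
  induction A using Finset.induction_on with
  | empty => intro k hk; simpa [partialSum] using hM k hk
  | insert a A haA ih =>
    intro k hk
    rw [Finset.card_insert_of_notMem haA, pow_succ]
    have hsplit := Finset.sum_filter_add_sum_filter_not
      ((Finset.Iic k).filter fun j => ∀ i ∈ A, j i = k i) (fun j => j a = k a) (fun j => X j ω)
    have e1 : ((Finset.Iic k).filter fun j => ∀ i ∈ A, j i = k i).filter (fun j => j a = k a) =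
        (Finset.Iic k).filter fun j => ∀ i ∈ insert a A, j i = k i := by
      ext j
      simp only [Finset.mem_filter, Finset.forall_mem_insert]
      tauto
    rw [e1] at hsplit
    have h1 := ih k hk
    have h2 : |∑ j ∈ ((Finset.Iic k).filter fun j => ∀ i ∈ A, j i = k i).filter
        (fun j => ¬ j a = k a), X j ω| ≤ 2 ^ A.card * M := by
      -- The part with `j a ≠ k a` is the increment in the directions `A` at `k` with its coordinate
      -- `a` lowered by one. When `k a = 1` there is no lower point (subtraction in `ℕ+` stays at 1)
      -- and that part is empty.
      by_cases hka : k a = 1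
      · rw [Finset.sum_eq_zero, abs_zero]
        · positivity
        · intro j hj
          simp only [Finset.mem_filter, Finset.mem_Iic] at hj
          exact absurd (le_antisymm (hj.1.1 a) (hka ▸ (one_le (a := j a)))) hj.2
      · set k' := Function.update k a (k a - 1) with hk'
        have hlt : k a - 1 < k a := by
          rw [← PNat.coe_lt_coe, PNat.sub_coe, if_pos (lt_of_le_of_ne (one_le (a := k a)) (Ne.symm hka))]
          have := (k a).pos
          simp
        have hk'k : k' ≤ k := update_le_self_iff.2 hlt.le
        have e2 : ((Finset.Iic k).filter fun j => ∀ i ∈ A, j i = k i).filter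
            (fun j => ¬ j a = k a) = (Finset.Iic k').filter fun j => ∀ i ∈ A, j i = k' i := by
          ext j
          have hA : (∀ i ∈ A, j i = k' i) ↔ ∀ i ∈ A, j i = k i :=
            forall₂_congr fun i hi => by
              have hia : i ≠ a := fun e => haA (e ▸ hi)
              rw [hk', Function.update_of_ne hia]
          have hle : j ≤ k' ↔ j ≤ k ∧ ¬ j a = k a := by
            rw [hk', le_update_iff, Pi.le_def]
            have hj : j a ≤ k a - 1 ↔ j a < k a := by
              rw [← PNat.coe_le_coe, ← PNat.coe_lt_coe, PNat.sub_coe,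
                if_pos (lt_of_le_of_ne (one_le (a := k a)) (Ne.symm hka))]
              have := (k a).pos
              simp only [PNat.one_coe]
              omega
            rw [hj]
            constructor
            · rintro ⟨h1, h2⟩
              refine ⟨fun i => ?_, h1.ne⟩
              by_cases hi : i = a
              · exact hi ▸ h1.le
              · exact h2 i hi
            · rintro ⟨h1, h2⟩
              exact ⟨lt_of_le_of_ne (h1 a) h2, fun i _ => h1 i⟩
          simp only [Finset.mem_filter, Finset.mem_Iic, hA, hle]
          tauto
        rw [e2]
        exact ih k' (hk'k.trans hk)
    rw [abs_le] at h1 h2 ⊢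
    constructor <;> linarith

/-- With increments taken in all `d` directions only the term at `k` itself survives. -/
theorem abs_le_of_abs_partialSum_le {Ω : Type*} (X : (Fin d → ℕ+) → Ω → ℝ) (ω : Ω)
    (n : Fin d → ℕ+) {M : ℝ} (hM : ∀ j ≤ n, |partialSum X j ω| ≤ M) {k : Fin d → ℕ+}
    (hk : k ≤ n) : |X k ω| ≤ 2 ^ d * M := by
  have := abs_sum_filter_le X ω n hM Finset.univ k hk
  have e : ((Finset.Iic k).filter fun j => ∀ i ∈ (Finset.univ : Finset (Fin d)), j i = k i) =
      {k} := by
    ext j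
    simp only [Finset.mem_filter, Finset.mem_Iic, Finset.mem_univ, true_implies,
      Finset.mem_singleton]
    exact ⟨fun h => funext h.2, fun h => ⟨h.le, fun i => h ▸ rfl⟩⟩
  rw [e] at this
  simpa using this

end Lattice

/-! ### Consequences of weak mean boundedness -/

section Domination

variable {d : ℕ} {Ω Ω' : Type*} [MeasurableSpace Ω] [MeasurableSpace Ω']
  {X : (Fin d → ℕ+) → Ω → ℝ} {P : Measure Ω} {ξ : Ω' → ℝ} {Q : Measure Ω'}
  {κ₁ κ₂ : ℝ} {n₀ : Fin d → ℕ+} {x₀ : ℝ}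

/-- Enlarging the box to `n * n₀`, which lies above both `n` and `n₀`, makes the bound available for
every `n` at the price of the factor `latticeSize n₀`. -/
theorem WeaklyMeanBounded.sum_le (h : WeaklyMeanBounded X P ξ Q κ₁ κ₂ n₀ x₀) {x : ℝ}
    (hx : x₀ < x) (n : Fin d → ℕ+) :
    ∑ k ∈ Finset.Iic n, P.real {ω | x < |X k ω|} ≤
      latticeSize n * latticeSize n₀ * κ₁ * Q.real {ω | x < |ξ ω|} := by
  have hle1 : n ≤ n * n₀ := fun i => le_mul_of_one_le_right' (one_le (a := n₀ i))
  have hle2 : n₀ ≤ n * n₀ := fun i => le_mul_of_one_le_left' (one_le (a := n i))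
  have h1 := h.upper x hx (n * n₀) hle2
  rw [one_div, inv_mul_le_iff₀ (latticeSize_pos _), latticeSize_mul] at h1
  calc _ ≤ ∑ k ∈ Finset.Iic (n * n₀), P.real {ω | x < |X k ω|} :=
        Finset.sum_le_sum_of_subset_of_nonneg (Finset.Iic_subset_Iic.2 hle1)
          fun _ _ _ => measureReal_nonneg
    _ ≤ _ := by linarith

theorem lintegral_sq_eq {Ω : Type*} [MeasurableSpace Ω] {P : Measure Ω} {Y : Ω → ℝ}
    (hY : Measurable Y) :
    ∫⁻ ω, ENNReal.ofReal (Y ω ^ 2) ∂P =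
      ∫⁻ t in Set.Ioi (0 : ℝ), P {ω | t < |Y ω|} * ENNReal.ofReal (2 * t) := by
  rw [← lintegral_comp_eq_lintegral_meas_lt_mul (g := fun t => 2 * t) P (Eventually.of_forall fun ω => abs_nonneg (Y ω))
    hY.abs.aemeasurable
    (fun t _ => (continuous_const.mul continuous_id).intervalIntegrable _ _)]
  · refine lintegral_congr fun ω => ?_
    congr 1
    rw [intervalIntegral.integral_const_mul, integral_id, sq_abs]
    ring
  · filter_upwards [ae_restrict_mem measurableSet_Ioi] with t ht
    exact mul_nonneg (by norm_num) (le_of_lt ht)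

/-- The origin of `sigmaOneSq`: in the layer cake for second moments, levels up to `x₀` use only
that probabilities are at most 1 and give `x₀ ^ 2`, while higher levels are compared with `ξ`. -/
theorem WeaklyMeanBounded.sum_lintegral_sq_le [IsProbabilityMeasure P] [IsProbabilityMeasure Q]
    (h : WeaklyMeanBounded X P ξ Q κ₁ κ₂ n₀ x₀)
    (hX : ∀ k, Measurable (X k)) (hξ : Measurable ξ) {σ : ℝ}
    (hint : Integrable (fun ω => ξ ω ^ 2) Q) (hσ : ∫ ω, ξ ω ^ 2 ∂Q = σ ^ 2) (n : Fin d → ℕ+) :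
    ∑ k ∈ Finset.Iic n, ∫⁻ ω, ENNReal.ofReal (X k ω ^ 2) ∂P ≤
      ENNReal.ofReal (latticeSize n * sigmaOneSq κ₁ n₀ x₀ σ) := by
  have hx0 := h.threshold_nonneg
  have hn := latticeSize_pos n
  have hn0 := latticeSize_pos n₀
  have hanti : ∀ k, Measurable fun t : ℝ => P {ω | t < |X k ω|} * ENNReal.ofReal (2 * t) := by
    intro k
    refine Measurable.mul ?_ (by fun_prop)
    have : Antitone fun t : ℝ => P {ω | t < |X k ω|} := fun t t' htt =>
      measure_mono fun ω (hω : t' < _) => htt.trans_lt hω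
    exact this.measurable
  have hantiξ : Measurable fun t : ℝ => Q {ω | t < |ξ ω|} * ENNReal.ofReal (2 * t) := by
    refine Measurable.mul ?_ (by fun_prop)
    have : Antitone fun t : ℝ => Q {ω | t < |ξ ω|} := fun t t' htt =>
      measure_mono fun ω (hω : t' < _) => htt.trans_lt hω
    exact this.measurable
  have hξ2 : ∫⁻ t in Set.Ioi (0 : ℝ), Q {ω | t < |ξ ω|} * ENNReal.ofReal (2 * t) =
      ENNReal.ofReal (σ ^ 2) := by
    rw [← lintegral_sq_eq hξ, ← hσ,
      ofReal_integral_eq_lintegral_ofReal hint (Eventually.of_forall fun _ => sq_nonneg _)]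
  have hsplit : Set.Ioi (0 : ℝ) = Set.Ioc 0 x₀ ∪ Set.Ioi x₀ := (Set.Ioc_union_Ioi_eq_Ioi hx0).symm
  have hsum : ∀ S : Set ℝ, ∑ k ∈ Finset.Iic n, ∫⁻ t in S,
      P {ω | t < |X k ω|} * ENNReal.ofReal (2 * t) =
      ∫⁻ t in S, (∑ k ∈ Finset.Iic n, P {ω | t < |X k ω|}) * ENNReal.ofReal (2 * t) := by
    intro S
    simp_rw [Finset.sum_mul]
    rw [lintegral_finsetSum _ fun k _ => hanti k]
  have hpt : ∀ t, ∑ k ∈ Finset.Iic n, P {ω | t < |X k ω|} =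
      ENNReal.ofReal (∑ k ∈ Finset.Iic n, P.real {ω | t < |X k ω|}) := by
    intro t
    rw [ENNReal.ofReal_sum_of_nonneg fun _ _ => measureReal_nonneg]
    exact Finset.sum_congr rfl fun k _ => (ofReal_measureReal).symm
  calc ∑ k ∈ Finset.Iic n, ∫⁻ ω, ENNReal.ofReal (X k ω ^ 2) ∂P
      = ∑ k ∈ Finset.Iic n, ∫⁻ t in Set.Ioi (0 : ℝ),
          P {ω | t < |X k ω|} * ENNReal.ofReal (2 * t) :=
        Finset.sum_congr rfl fun k _ => lintegral_sq_eq (hX k)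
    _ ≤ (∫⁻ t in Set.Ioc 0 x₀, (∑ k ∈ Finset.Iic n, P {ω | t < |X k ω|}) *
          ENNReal.ofReal (2 * t)) + ∫⁻ t in Set.Ioi x₀,
          (∑ k ∈ Finset.Iic n, P {ω | t < |X k ω|}) * ENNReal.ofReal (2 * t) := by
        rw [hsum, hsplit]
        exact lintegral_union_le _ _ _
    _ ≤ (∫⁻ t in Set.Ioc 0 x₀, ENNReal.ofReal (latticeSize n * (2 * t))) + ∫⁻ t in Set.Ioi x₀,
          ENNReal.ofReal (latticeSize n * latticeSize n₀ * κ₁) *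
            (Q {ω | t < |ξ ω|} * ENNReal.ofReal (2 * t)) := by
        refine add_le_add (lintegral_mono fun t => ?_)
          (setLIntegral_mono' measurableSet_Ioi fun t ht => ?_)
        · rw [ENNReal.ofReal_mul hn.le, hpt]
          gcongr
          rw [latticeSize_eq_card]
          refine (Finset.sum_le_card_nsmul _ _ 1 fun k _ => measureReal_le_one).trans ?_
          simp
        · rw [← mul_assoc, hpt]
          gcongr
          rw [← ofReal_measureReal, ← ENNReal.ofReal_mul
            (mul_nonneg (mul_nonneg hn.le hn0.le) h.pos_left.le)]
          exact ENNReal.ofReal_le_ofReal (h.sum_le ht n)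
    _ ≤ ENNReal.ofReal (latticeSize n * x₀ ^ 2) +
          ENNReal.ofReal (latticeSize n * latticeSize n₀ * κ₁) * ENNReal.ofReal (σ ^ 2) := by
        refine add_le_add (le_of_eq ?_) ?_
        · have hc : Continuous fun t : ℝ => latticeSize n * (2 * t) := by fun_prop
          rw [← ofReal_integral_eq_lintegral_ofReal
            (hc.integrableOn_Icc.mono_set Set.Ioc_subset_Icc_self)]
          · congr 1
            rw [← intervalIntegral.integral_of_le hx0, intervalIntegral.integral_const_mul,
              intervalIntegral.integral_const_mul, integral_id]
            ring
          · filter_upwards [ae_restrict_mem measurableSet_Ioc] with t ht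
            exact mul_nonneg hn.le (mul_nonneg (by norm_num) ht.1.le)
        · rw [lintegral_const_mul _ hantiξ, ← hξ2]
          gcongr
    _ ≤ ENNReal.ofReal (latticeSize n * sigmaOneSq κ₁ n₀ x₀ σ) := by
        have := h.pos_left
        rw [← ENNReal.ofReal_mul (by positivity), ← ENNReal.ofReal_add (by positivity)
          (by positivity)]
        refine ENNReal.ofReal_le_ofReal ?_
        rw [sigmaOneSq]
        have h1 := one_le_latticeSize n₀
        nlinarith [mul_nonneg hn.le (mul_nonneg (sub_nonneg.2 h1) (sq_nonneg x₀))]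

theorem WeaklyMeanBounded.integrable_sq [IsProbabilityMeasure P] [IsProbabilityMeasure Q]
    (h : WeaklyMeanBounded X P ξ Q κ₁ κ₂ n₀ x₀)
    (hX : ∀ k, Measurable (X k)) (hξ : Measurable ξ)
    (hint : Integrable (fun ω => ξ ω ^ 2) Q) (n : Fin d → ℕ+) :
    Integrable (fun ω => X n ω ^ 2) P := by
  obtain ⟨σ, hσ⟩ : ∃ σ : ℝ, ∫ ω, ξ ω ^ 2 ∂Q = σ ^ 2 :=
    ⟨Real.sqrt (∫ ω, ξ ω ^ 2 ∂Q), (Real.sq_sqrt (integral_nonneg fun _ => sq_nonneg _)).symm⟩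
  refine ⟨((hX n).pow_const 2).aestronglyMeasurable, ?_⟩
  rw [hasFiniteIntegral_iff_ofReal (Eventually.of_forall fun _ => sq_nonneg _)]
  refine lt_of_le_of_lt ((Finset.single_le_sum (f := fun k => ∫⁻ ω, ENNReal.ofReal (X k ω ^ 2) ∂P)
    (fun _ _ => zero_le) (Finset.mem_Iic.2 le_rfl)).trans
    (h.sum_lintegral_sq_le hX hξ hint hσ n)) ENNReal.ofReal_lt_top

theorem WeaklyMeanBounded.sum_integral_sq_le [IsProbabilityMeasure P] [IsProbabilityMeasure Q]
    (h : WeaklyMeanBounded X P ξ Q κ₁ κ₂ n₀ x₀)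
    (hX : ∀ k, Measurable (X k)) (hξ : Measurable ξ) {σ : ℝ}
    (hint : Integrable (fun ω => ξ ω ^ 2) Q) (hσ : ∫ ω, ξ ω ^ 2 ∂Q = σ ^ 2) (n : Fin d → ℕ+) :
    ∑ k ∈ Finset.Iic n, ∫ ω, X k ω ^ 2 ∂P ≤ latticeSize n * sigmaOneSq κ₁ n₀ x₀ σ := by
  have h1 := h.sum_lintegral_sq_le hX hξ hint hσ n
  rw [Finset.sum_congr rfl fun k _ => (ofReal_integral_eq_lintegral_ofReal
    (h.integrable_sq hX hξ hint k) (Eventually.of_forall fun _ => sq_nonneg _)).symm,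
    ← ENNReal.ofReal_sum_of_nonneg fun _ _ => integral_nonneg fun _ => sq_nonneg _] at h1
  refine (ENNReal.ofReal_le_ofReal_iff ?_).1 h1
  have := h.pos_left
  have := latticeSize_pos n
  have := latticeSize_pos n₀
  unfold sigmaOneSq
  positivity

theorem WeaklyMeanBounded.neg (h : WeaklyMeanBounded X P ξ Q κ₁ κ₂ n₀ x₀) :
    WeaklyMeanBounded (fun k ω => -X k ω) P ξ Q κ₁ κ₂ n₀ x₀ where
  pos_left := h.pos_left
  pos_right := h.pos_right
  threshold_nonneg := h.threshold_nonneg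
  lower := by simpa only [abs_neg] using h.lower
  upper := by simpa only [abs_neg] using h.upper

end Domination

/-! ### Calculus of `logPlus` -/

section LogPlus

theorem one_le_logPlus (x : ℝ) : 1 ≤ logPlus x := le_max_left _ _

theorem logPlus_pos (x : ℝ) : 0 < logPlus x := one_pos.trans_le (one_le_logPlus x)

theorem log_le_logPlus (x : ℝ) : Real.log x ≤ logPlus x := le_max_right _ _

theorem measurable_logPlus : Measurable logPlus := measurable_const.max Real.measurable_log

theorem logPlus_le_logPlus {x y : ℝ} (hx : 1 ≤ x) (hxy : x ≤ y) : logPlus x ≤ logPlus y :=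
  max_le_max le_rfl (Real.log_le_log (one_pos.trans_le hx) hxy)

theorem logPlus_mul_le (x y : ℝ) : logPlus (x * y) ≤ 2 * logPlus x * logPlus y := by
  have hx := one_le_logPlus x
  have hy := one_le_logPlus y
  refine max_le (by nlinarith) ?_
  by_cases h : x = 0 ∨ y = 0
  · rw [mul_eq_zero.2 h, Real.log_zero]; positivity
  · push Not at h
    rw [Real.log_mul h.1 h.2]
    nlinarith [log_le_logPlus x, log_le_logPlus y]

theorem exists_logPlus_rpow_le {c e : ℝ} (hc : 0 ≤ c) (he : 0 < e) :
    ∃ K : ℝ, 0 < K ∧ ∀ x : ℝ, 1 ≤ x → logPlus x ^ c ≤ K * x ^ e := by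
  -- Dividing by `c + 1` instead of `c` also covers `c = 0`.
  set e' := e / (c + 1) with he'
  have he'0 : 0 < e' := by positivity
  refine ⟨(max 1 (1 / e')) ^ (c + 1), by positivity, fun x hx => ?_⟩
  have hx0 : 0 ≤ x := by linarith
  have h1 : logPlus x ≤ max 1 (1 / e') * x ^ e' := by
    have hxe : 1 ≤ x ^ e' := Real.one_le_rpow hx he'0.le
    refine max_le ?_ ?_
    · nlinarith [le_max_left 1 (1 / e')]
    · refine (Real.log_le_rpow_div hx0 he'0).trans ?_
      rw [div_eq_mul_one_div, mul_comm]
      exact mul_le_mul_of_nonneg_right (le_max_right _ _) (by positivity)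
  calc logPlus x ^ c ≤ logPlus x ^ (c + 1) :=
        Real.rpow_le_rpow_of_exponent_le (one_le_logPlus x) (by linarith)
    _ ≤ (max 1 (1 / e') * x ^ e') ^ (c + 1) :=
        Real.rpow_le_rpow (logPlus_pos x).le h1 (by positivity)
    _ = (max 1 (1 / e')) ^ (c + 1) * x ^ e := by
        rw [Real.mul_rpow (by positivity) (by positivity), ← Real.rpow_mul hx0, he',
          div_mul_cancel₀ _ (by positivity)]

/-- The exponent `p - 1 - r / 2` may have either sign, so comparability is needed in both
directions. -/
theorem rpow_le_of_comparable {u v A B β : ℝ} (hu : 0 < u) (hv : 0 < v) (hA : 0 < A) (hB : 0 < B)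
    (huv : u ≤ A * v) (hvu : v ≤ B * u) : u ^ β ≤ (A ^ β + B ^ (-β)) * v ^ β := by
  rcases le_total 0 β with h | h
  · calc u ^ β ≤ (A * v) ^ β := Real.rpow_le_rpow hu.le huv h
      _ = A ^ β * v ^ β := Real.mul_rpow hA.le hv.le
      _ ≤ _ := by
        gcongr
        have := Real.rpow_nonneg hB.le (-β)
        linarith
  · have h1 : B⁻¹ * v ≤ u := by rwa [inv_mul_le_iff₀ hB]
    calc u ^ β ≤ (B⁻¹ * v) ^ β := Real.rpow_le_rpow_of_nonpos (by positivity) h1 h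
      _ = B ^ (-β) * v ^ β := by
        rw [Real.mul_rpow (by positivity) hv.le, Real.inv_rpow hB.le, Real.rpow_neg hB.le]
      _ ≤ _ := by
        gcongr
        have := Real.rpow_nonneg hA.le β
        linarith

theorem exists_logPlus_const_mul_rpow_le {c : ℝ} (hc : 0 < c) (β : ℝ) :
    ∃ K : ℝ, 0 < K ∧ ∀ x : ℝ, logPlus (c * x) ^ β ≤ K * logPlus x ^ β := by
  have hA : 0 < 2 * logPlus c := by have := logPlus_pos c; positivity
  have hB : 0 < 2 * logPlus c⁻¹ := by have := logPlus_pos c⁻¹; positivity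
  refine ⟨(2 * logPlus c) ^ β + (2 * logPlus c⁻¹) ^ (-β), by positivity, fun x => ?_⟩
  refine rpow_le_of_comparable (logPlus_pos _) (logPlus_pos _) hA hB (logPlus_mul_le c x) ?_
  have := logPlus_mul_le c⁻¹ (c * x)
  rwa [inv_mul_cancel_left₀ hc.ne'] at this

theorem LogMomentFinite.const_mul {Ω : Type*} [MeasurableSpace Ω] {ξ : Ω → ℝ} {Q : Measure Ω}
    {r : ℝ} {p : ℕ} (hξ : Measurable ξ) (h : LogMomentFinite ξ Q r p) {c : ℝ} (hc : 0 < c) :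
    LogMomentFinite (fun ω => c * ξ ω) Q r p := by
  obtain ⟨K, hK, hKx⟩ := exists_logPlus_const_mul_rpow_le hc ((p : ℝ) - 1 - r / 2)
  refine (Integrable.const_mul h (c ^ r * K)).mono' ?_ (Eventually.of_forall fun ω => ?_)
  · have h1 : Measurable fun ω => |c * ξ ω| := (hξ.const_mul c).abs
    exact ((h1.pow_const r).mul ((measurable_logPlus.comp h1).pow_const _)).aestronglyMeasurable
  · have h1 : 0 ≤ |c * ξ ω| ^ r * logPlus |c * ξ ω| ^ ((p : ℝ) - 1 - r / 2) :=
      mul_nonneg (by positivity) (Real.rpow_nonneg (logPlus_pos _).le _)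
    rw [Real.norm_of_nonneg h1, abs_mul, abs_of_pos hc, Real.mul_rpow hc.le (abs_nonneg _)]
    calc _ ≤ c ^ r * |ξ ω| ^ r * (K * logPlus |ξ ω| ^ ((p : ℝ) - 1 - r / 2)) := by
          gcongr
          exact hKx _
      _ = _ := by ring

/-- Inversion of `h ↦ h log h`. -/
theorem mul_logPlus_le_of_mul_log_lt {h Q x : ℝ} (hh : 2 ≤ h) (hQ : 1 ≤ Q) (hx : 1 ≤ x)
    (hlt : h * Real.log h * Q < x ^ 2) : h * logPlus x ≤ 4 * x ^ 2 * logPlus Q / Q := by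
  have hQ0 : 0 < Q := by linarith
  set w := x ^ 2 / Q with hw
  have hw1 : h * Real.log h < w := by rwa [hw, lt_div_iff₀ hQ0]
  have hl2 := Real.log_two_gt_d9
  have hlh : Real.log 2 ≤ Real.log h := Real.log_le_log (by norm_num) hh
  have hw0 : 0 < w := lt_trans (mul_pos (by linarith) (by linarith)) hw1
  have h1 : h * logPlus w ≤ 2 * w := by
    unfold logPlus
    rw [mul_max_of_nonneg _ _ (by linarith)]
    refine max_le (by nlinarith) ?_
    -- If `h ≤ √w`, the bound `log w ≤ 2 √w` is enough. If `h > √w`, then `log w ≤ 2 log h`, and `h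
    -- log h < w` is known.
    rcases le_or_gt h (Real.sqrt w) with hc | hc
    · have h2 : Real.log w ≤ 2 * Real.sqrt w := by
        have := Real.log_le_sub_one_of_pos (Real.sqrt_pos.2 hw0)
        rw [Real.log_sqrt hw0.le] at this
        linarith
      have h3 := Real.mul_self_sqrt hw0.le
      rcases le_or_gt 0 (Real.log w) with h4 | h4
      · nlinarith [Real.sqrt_nonneg w]
      · nlinarith
    · have h2 : w < h ^ 2 := (Real.sqrt_lt' (by linarith)).1 hc
      have h3 : Real.log w ≤ 2 * Real.log h := by
        have := Real.log_le_log hw0 h2.le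
        rwa [Real.log_pow, Nat.cast_ofNat] at this
      nlinarith
  have h2 : logPlus x ≤ 2 * logPlus w * logPlus Q := by
    refine le_trans ?_ (logPlus_mul_le w Q)
    rw [hw, div_mul_cancel₀ _ hQ0.ne']
    exact logPlus_le_logPlus hx (by nlinarith)
  have h3 : 4 * x ^ 2 * logPlus Q / Q = 4 * w * logPlus Q := by rw [hw]; ring
  rw [h3]
  have hlQ := logPlus_pos Q
  calc h * logPlus x ≤ h * (2 * logPlus w * logPlus Q) := by gcongr
    _ = 2 * (h * logPlus w) * logPlus Q := by ring
    _ ≤ 2 * (2 * w) * logPlus Q := by gcongr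
    _ = _ := by ring

end LogPlus

/-! ### Sums over positive integers and product weights -/

section Sums

theorem ENNReal.tsum_pi_prod_le {ι β : Type*} [Fintype ι] (w : ι → β → ℝ≥0∞) :
    ∑' v : ι → β, ∏ i, w i (v i) ≤ ∏ i, ∑' j, w i j := by
  classical
  rw [ENNReal.tsum_eq_iSup_sum]
  refine iSup_le fun F => ?_
  calc ∑ v ∈ F, ∏ i, w i (v i)
      ≤ ∑ v ∈ Fintype.piFinset fun i => F.image fun v => v i, ∏ i, w i (v i) :=
        Finset.sum_le_sum_of_subset fun v hv =>
          Fintype.mem_piFinset.2 fun i => Finset.mem_image_of_mem _ hv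
    _ = ∏ i, ∑ j ∈ F.image fun v => v i, w i j := (Finset.prod_univ_sum _ _).symm
    _ ≤ _ := Finset.prod_le_prod' fun i _ => ENNReal.sum_le_tsum _

theorem tsum_pnat_rpow_le {s : ℝ} (hs : 1 ≤ s) (W : ℝ) :
    ∑' a : ℕ+, (if (a : ℝ) ≤ W then ENNReal.ofReal ((a : ℝ) ^ (s - 1)) else 0) ≤
      ENNReal.ofReal (W ^ s) := by
  rcases lt_or_ge W 1 with hW | hW
  · rw [ENNReal.tsum_eq_zero.2]
    · exact zero_le
    · intro a
      rw [if_neg]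
      have : (1 : ℝ) ≤ a := by exact_mod_cast a.pos
      linarith
  obtain ⟨N, hN⟩ : ∃ N : ℕ+, (N : ℕ) = ⌊W⌋₊ := ⟨Nat.toPNat _ (Nat.floor_pos.2 hW), rfl⟩
  have hmem : ∀ a : ℕ+, (a : ℝ) ≤ W ↔ a ≤ N := by
    intro a
    rw [← PNat.coe_le_coe, hN, Nat.le_floor_iff (by linarith)]
  rw [tsum_eq_sum (s := Finset.Icc 1 N)]
  · calc _ ≤ ∑ a ∈ Finset.Icc 1 N, ENNReal.ofReal (W ^ (s - 1)) := by
          refine Finset.sum_le_sum fun a _ => ?_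
          split_ifs with h
          · exact ENNReal.ofReal_le_ofReal (Real.rpow_le_rpow (by positivity) h (by linarith))
          · exact zero_le
      _ = ENNReal.ofReal (⌊W⌋₊ * W ^ (s - 1)) := by
          rw [Finset.sum_const, PNat.card_Icc, ENNReal.ofReal_mul (by positivity), ← hN]
          simp
      _ ≤ _ := by
          refine ENNReal.ofReal_le_ofReal ?_
          calc _ ≤ W * W ^ (s - 1) := by
                gcongr
                exact Nat.floor_le (by linarith)
            _ = W ^ s := by
                rw [← Real.rpow_one_add' (by linarith) (by linarith)]
                congr 1; ring
  · intro a ha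
    rw [if_neg]
    rw [hmem]
    simpa using ha

theorem tsum_pnat_inv_le {x : ℝ} (hx : 1 ≤ x) :
    ∑' a : ℕ+, (if (a : ℝ) ≤ 2 * x ^ 2 then ENNReal.ofReal ((a : ℝ)⁻¹) else 0) ≤
      ENNReal.ofReal (4 * logPlus x) := by
  have hW : 1 ≤ 2 * x ^ 2 := by nlinarith
  set W := 2 * x ^ 2 with hWdef
  obtain ⟨N, hN⟩ : ∃ N : ℕ+, (N : ℕ) = ⌊W⌋₊ := ⟨Nat.toPNat _ (Nat.floor_pos.2 hW), rfl⟩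
  have hmem : ∀ a : ℕ+, (a : ℝ) ≤ W ↔ a ≤ N := by
    intro a
    rw [← PNat.coe_le_coe, hN, Nat.le_floor_iff (by linarith)]
  rw [tsum_eq_sum (s := Finset.Icc 1 N)]
  · calc _ ≤ ∑ a ∈ Finset.Icc 1 N, ENNReal.ofReal ((a : ℝ)⁻¹) := by
          refine Finset.sum_le_sum fun a _ => ?_
          split_ifs with h
          · exact le_rfl
          · exact zero_le
      _ = ENNReal.ofReal (∑ a ∈ Finset.Icc 1 N, ((a : ℕ) : ℝ)⁻¹) := by
          rw [ENNReal.ofReal_sum_of_nonneg fun _ _ => by positivity]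
      _ = ENNReal.ofReal (∑ a ∈ Finset.Icc 1 ⌊W⌋₊, (a : ℝ)⁻¹) := by
          congr 1
          rw [← hN]
          refine Finset.sum_bij (fun a _ => (a : ℕ)) ?_ ?_ ?_ ?_
          · intro a ha
            rw [Finset.mem_Icc] at ha ⊢
            exact ⟨a.pos, ha.2⟩
          · intro a _ b _ hab
            exact PNat.coe_injective hab
          · intro b hb
            rw [Finset.mem_Icc] at hb
            exact ⟨Nat.toPNat b hb.1, Finset.mem_Icc.2 ⟨one_le, hb.2⟩, rfl⟩
          · intro a _
            rfl
      _ ≤ _ := by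
          refine ENNReal.ofReal_le_ofReal ?_
          have h1 := harmonic_le_one_add_log ⌊W⌋₊
          rw [harmonic_eq_sum_Icc] at h1
          push_cast at h1
          refine h1.trans ?_
          have h2 : Real.log ⌊W⌋₊ ≤ Real.log W :=
            Real.log_le_log (by rw [← hN]; exact_mod_cast N.pos) (Nat.floor_le (by linarith))
          have h3 : Real.log W = Real.log 2 + 2 * Real.log x := by
            rw [hWdef, Real.log_mul (by norm_num) (by positivity), Real.log_pow]
            norm_num
          have := Real.log_two_lt_d9
          have := log_le_logPlus x
          have := one_le_logPlus x
          linarith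
  · intro a ha
    rw [if_neg]
    rw [hmem]
    simpa using ha

theorem tsum_pnat_rpow_neg_lt_top {e : ℝ} (he : 1 < e) :
    ∑' a : ℕ+, ENNReal.ofReal ((a : ℝ) ^ (-e)) < ∞ := by
  have h1 : Summable fun n : ℕ => (n : ℝ) ^ (-e) := Real.summable_nat_rpow.2 (by linarith)
  have h2 : Summable fun a : ℕ+ => ((a : ℕ) : ℝ) ^ (-e) := h1.comp_injective PNat.coe_injective
  rw [← ENNReal.ofReal_tsum_of_nonneg (fun _ => by positivity) h2]
  exact ENNReal.ofReal_lt_top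

end Sums

/-! ### The head and the tail of the norming -/

section Norming

variable {d : ℕ} {p : ℕ} {α : Fin d → ℝ}

theorem one_le_headProd (p : ℕ) (n : Fin d → ℕ+) : 1 ≤ headProd p n :=
  Finset.one_le_prod fun i _ => Nat.one_le_cast.2 (PNat.pos (n i))

theorem two_le_headProd {n : Fin d → ℕ+} (h : 1 < headProd p n) : 2 ≤ headProd p n := by
  have e : headProd p n = ((∏ i : Fin d with i.val < p, (n i : ℕ) : ℕ) : ℝ) := by
    simp [headProd]
  rw [e] at h ⊢
  exact_mod_cast h

/-- The product of the coordinates that do not belong to the head. -/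
def tailProd (p : ℕ) (n : Fin d → ℕ+) : ℝ := ∏ i : Fin d with p ≤ i.val, (n i : ℝ)

/-- The square of the tail factor of `logNorming`. -/
def tailPow (p : ℕ) (α : Fin d → ℝ) (n : Fin d → ℕ+) : ℝ :=
  ∏ i : Fin d with p ≤ i.val, (n i : ℝ) ^ (2 * α i)

theorem headProd_mul_tailProd (p : ℕ) (n : Fin d → ℕ+) :
    headProd p n * tailProd p n = latticeSize n := by
  have := Finset.prod_filter_mul_prod_filter_not (Finset.univ : Finset (Fin d))
    (fun i => i.val < p) (fun i => (n i : ℝ))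
  simp only [not_lt] at this
  exact this

theorem one_le_tailProd (p : ℕ) (n : Fin d → ℕ+) : 1 ≤ tailProd p n :=
  Finset.one_le_prod fun i _ => Nat.one_le_cast.2 (PNat.pos (n i))

theorem tailProd_rpow_le_tailPow {γ : ℝ} (hα : ∀ i : Fin d, p ≤ i.val → 1 + γ ≤ 2 * α i)
    (n : Fin d → ℕ+) : tailProd p n ^ (1 + γ) ≤ tailPow p α n := by
  rw [tailProd, ← Real.finsetProd_rpow _ _ fun i _ => by positivity]
  refine Finset.prod_le_prod (fun i _ => by positivity) fun i hi => ?_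
  exact Real.rpow_le_rpow_of_exponent_le (Nat.one_le_cast.2 (PNat.pos (n i)))
    (hα i (Finset.mem_filter.1 hi).2)

theorem logNorming_nonneg (p : ℕ) (α : Fin d → ℝ) (n : Fin d → ℕ+) : 0 ≤ logNorming p α n :=
  mul_nonneg (Real.sqrt_nonneg _) (Finset.prod_nonneg fun i _ => by positivity)

theorem logNorming_sq (p : ℕ) (α : Fin d → ℝ) (n : Fin d → ℕ+) :
    logNorming p α n ^ 2 = headProd p n * Real.log (headProd p n) * tailPow p α n := by
  have h1 := one_le_headProd p n
  rw [logNorming, mul_pow, Real.sq_sqrt (mul_nonneg (by linarith) (Real.log_nonneg h1)), tailPow,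
    ← Finset.prod_pow]
  congr 1
  refine Finset.prod_congr rfl fun i _ => ?_
  rw [← Real.rpow_natCast, ← Real.rpow_mul (by positivity), mul_comm]
  norm_num

theorem exists_gap (hα : ∀ i : Fin d, p ≤ i.val → 1 / 2 < α i) :
    ∃ γ : ℝ, 0 < γ ∧ ∀ i : Fin d, p ≤ i.val → 1 + γ ≤ 2 * α i := by
  have h1 : ∀ᶠ γ : ℝ in 𝓝[>] 0, ∀ i : Fin d, p ≤ i.val → 1 + γ ≤ 2 * α i := by
    rw [Filter.eventually_all]
    intro i
    by_cases hi : p ≤ i.val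
    · have : ∀ᶠ γ : ℝ in 𝓝[>] 0, γ < 2 * α i - 1 :=
        nhdsWithin_le_nhds (Iio_mem_nhds (by linarith [hα i hi]))
      filter_upwards [this] with γ hγ _
      linarith
    · simp [hi]
  obtain ⟨γ, h, h0⟩ := (h1.and self_mem_nhdsWithin).exists
  exact ⟨γ, h0, h⟩

theorem one_le_tailPow (hα : ∀ i : Fin d, p ≤ i.val → 1 / 2 < α i) (n : Fin d → ℕ+) :
    1 ≤ tailPow p α n :=
  Finset.one_le_prod fun i hi => Real.one_le_rpow (Nat.one_le_cast.2 (PNat.pos (n i)))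
    (by linarith [hα i (Finset.mem_filter.1 hi).2])

/-- Holds because `log 2 ≥ 1 / 2`. It confines every head coordinate to `[1, 2 x²]` when the norming
is below `x`, so that the harmonic sums in the count are finite. -/
theorem headProd_le_sq (hα : ∀ i : Fin d, p ≤ i.val → 1 / 2 < α i) {n : Fin d → ℕ+}
    (h : 1 < headProd p n) : headProd p n ≤ 2 * logNorming p α n ^ 2 := by
  have h2 := two_le_headProd h
  have h3 := one_le_tailPow hα n
  have h4 := Real.log_two_gt_d9
  have h5 : Real.log 2 ≤ Real.log (headProd p n) := Real.log_le_log (by norm_num) h2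
  rw [logNorming_sq]
  have h7 : 0 ≤ headProd p n * Real.log (headProd p n) :=
    mul_nonneg (by linarith) (by linarith)
  have h6 : headProd p n * (1 / 2) * 1 ≤
      headProd p n * Real.log (headProd p n) * tailPow p α n := by
    gcongr
    linarith
  linarith

theorem one_le_logNorming (hα : ∀ i : Fin d, p ≤ i.val → 1 / 2 < α i) {n : Fin d → ℕ+}
    (h : 1 < headProd p n) : 1 ≤ logNorming p α n := by
  have := headProd_le_sq hα h
  have := two_le_headProd h
  have := logNorming_nonneg p α n
  nlinarith

theorem le_headProd {n : Fin d → ℕ+} {i : Fin d} (hi : i.val < p) : (n i : ℝ) ≤ headProd p n := by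
  rw [headProd, ← Finset.mul_prod_erase _ _ (Finset.mem_filter.2 ⟨Finset.mem_univ i, hi⟩)]
  exact le_mul_of_one_le_right (by positivity)
    (Finset.one_le_prod fun j _ => Nat.one_le_cast.2 (PNat.pos (n j)))

end Norming

/-! ### Upper bound for the weighted count of points with small norming -/

section Count

variable {k : ℕ}

theorem headProd_cons {p : ℕ} (hp : 1 ≤ p) (a : ℕ+) (v : Fin k → ℕ+) :
    headProd p (Fin.cons a v : Fin (k + 1) → ℕ+) = a * headProd (p - 1) v := by
  rw [headProd, headProd, Finset.prod_filter, Finset.prod_filter, Fin.prod_univ_succ]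
  simp only [Fin.val_zero, Fin.cons_zero, Fin.val_succ, Fin.cons_succ,
    show ∀ j : ℕ, (j + 1 < p) = (j < p - 1) from fun j => by rw [eq_iff_iff]; omega]
  rw [if_pos (by omega)]

theorem tailProd_cons {p : ℕ} (hp : 1 ≤ p) (a : ℕ+) (v : Fin k → ℕ+) :
    tailProd p (Fin.cons a v : Fin (k + 1) → ℕ+) = tailProd (p - 1) v := by
  rw [tailProd, tailProd, Finset.prod_filter, Finset.prod_filter, Fin.prod_univ_succ]
  simp only [Fin.val_zero, Fin.cons_zero, Fin.val_succ, Fin.cons_succ,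
    show ∀ j : ℕ, (p ≤ j + 1) = (p - 1 ≤ j) from fun j => by rw [eq_iff_iff]; omega]
  rw [if_neg (by omega), one_mul]

theorem tailPow_cons {p : ℕ} (hp : 1 ≤ p) (α : Fin (k + 1) → ℝ) (a : ℕ+) (v : Fin k → ℕ+) :
    tailPow p α (Fin.cons a v : Fin (k + 1) → ℕ+) = tailPow (p - 1) (fun i => α i.succ) v := by
  rw [tailPow, tailPow, Finset.prod_filter, Finset.prod_filter, Fin.prod_univ_succ]
  simp only [Fin.val_zero, Fin.cons_zero, Fin.val_succ, Fin.cons_succ,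
    show ∀ j : ℕ, (p ≤ j + 1) = (p - 1 ≤ j) from fun j => by rw [eq_iff_iff]; omega]
  rw [if_neg (by omega), one_mul]

theorem tsum_pi_succ (f : (Fin (k + 1) → ℕ+) → ℝ≥0∞) :
    ∑' n, f n = ∑' v : Fin k → ℕ+, ∑' a : ℕ+, f (Fin.cons a v) := by
  rw [← (Fin.consEquiv fun _ : Fin (k + 1) => ℕ+).tsum_eq f, ENNReal.tsum_comm]
  exact ENNReal.tsum_prod (f := fun (a : ℕ+) (v : Fin k → ℕ+) => f (Fin.cons a v))

/-- The tail exponents exceed `1 / 2` by a fixed gap. Half of it absorbs the logarithm, since `e`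
satisfies `(1 + γ) * (e - 1) = -(1 + γ / 2)`; the other half leaves an exponent below `-1`, so the
tail coordinates are summable. -/
theorem exists_tailProd_mul_le {d p : ℕ} {α : Fin d → ℝ} {γ s : ℝ} (hγ : 0 < γ) (hs : 1 ≤ s)
    (hα : ∀ i : Fin d, p ≤ i.val → 1 + γ ≤ 2 * α i) :
    ∃ K : ℝ, 0 < K ∧ ∀ v : Fin d → ℕ+,
      tailProd p v ^ (s - 1) * (logPlus (tailPow p α v) / tailPow p α v) ^ s ≤
        K * tailProd p v ^ (-(1 + γ * s / 2)) := by
  set e := γ / (2 * (1 + γ)) with he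
  have he0 : 0 < e := by positivity
  obtain ⟨K, hK, hKx⟩ := exists_logPlus_rpow_le zero_le_one he0
  refine ⟨K ^ s, by positivity, fun v => ?_⟩
  have hq := one_le_tailProd p v
  have hqQ := tailProd_rpow_le_tailPow hα v
  set q := tailProd p v
  set Q := tailPow p α v
  have hq0 : 0 < q := by linarith
  have hQ1 : 1 ≤ Q := (Real.one_le_rpow hq (by linarith)).trans hqQ
  have hQ0 : 0 < Q := by linarith
  have h1 : logPlus Q / Q ≤ K * q ^ (-(1 + γ / 2)) := by
    have h2 := hKx Q hQ1
    rw [Real.rpow_one] at h2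
    have he1 : e < 1 := by rw [he, div_lt_one (by positivity)]; linarith
    calc logPlus Q / Q ≤ K * Q ^ e / Q := by gcongr
      _ = K * Q ^ (e - 1) := by rw [Real.rpow_sub_one hQ0.ne']; ring
      _ ≤ K * (q ^ (1 + γ)) ^ (e - 1) := by
        gcongr 1
        exact Real.rpow_le_rpow_of_nonpos (by positivity) hqQ (by linarith)
      _ = K * q ^ (-(1 + γ / 2)) := by
        rw [← Real.rpow_mul hq0.le]
        congr 2
        rw [he]; field_simp; ring
  calc q ^ (s - 1) * (logPlus Q / Q) ^ s ≤ q ^ (s - 1) * (K * q ^ (-(1 + γ / 2))) ^ s := by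
        have := (logPlus_pos Q).le
        gcongr
    _ = K ^ s * q ^ (-(1 + γ * s / 2)) := by
        rw [Real.mul_rpow hK.le (by positivity), ← Real.rpow_mul hq0.le, mul_left_comm,
          ← Real.rpow_add hq0]
        congr 2; ring

/-- The number of lattice points below a level of the norming, with weights. -/
theorem exists_count_le {p : ℕ} (hp : 1 ≤ p) (hpk : p ≤ k + 1) {α : Fin (k + 1) → ℝ}
    (hα : ∀ i : Fin (k + 1), p ≤ i.val → 1 / 2 < α i) {s : ℝ} (hs : 1 ≤ s) :
    ∃ C : ℝ, 0 < C ∧ ∀ x : ℝ, 0 ≤ x →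
      ∑' n : Fin (k + 1) → ℕ+, (if 1 < headProd p n ∧ logNorming p α n < x then
        ENNReal.ofReal (latticeSize n ^ (s - 1)) else 0) ≤
      ENNReal.ofReal (C * (x ^ (2 * s) * logPlus x ^ ((p : ℝ) - 1 - s))) := by
  obtain ⟨γ, hγ, hγα⟩ := exists_gap hα
  have hγα' : ∀ i : Fin k, p - 1 ≤ i.val → 1 + γ ≤ 2 * α i.succ := fun i hi =>
    hγα i.succ (by rw [Fin.val_succ]; omega)
  obtain ⟨K, hK, hKv⟩ := exists_tailProd_mul_le (α := fun i : Fin k => α i.succ) hγ hs hγα'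
  have he : 1 < 1 + γ * s / 2 := by have := mul_pos hγ (one_pos.trans_le hs); linarith
  set e := 1 + γ * s / 2 with hedef
  set Z := (∑' a : ℕ+, ENNReal.ofReal ((a : ℝ) ^ (-e))).toReal + 1 with hZ
  have hZ0 : 0 < Z := by positivity
  have hZt : ∑' a : ℕ+, ENNReal.ofReal ((a : ℝ) ^ (-e)) ≤ ENNReal.ofReal Z := by
    rw [← ENNReal.ofReal_toReal (tsum_pnat_rpow_neg_lt_top he).ne]
    exact ENNReal.ofReal_le_ofReal (by linarith)
  set T := (Finset.univ.filter fun i : Fin k => p - 1 ≤ i.val).card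
  have hcard : (Finset.univ.filter fun i : Fin k => i.val < p - 1).card = p - 1 := by
    rw [Fin.card_filter_val_lt]; omega
  -- The first coordinate contributes `4 ^ s`, the tail logarithm `K`, each of the `p - 1` other
  -- head coordinates a 4, and each of the `T` tail coordinates a `Z`.
  refine ⟨4 ^ s * K * (4 ^ (p - 1) * Z ^ T), by positivity, fun x hx0 => ?_⟩
  rcases lt_or_ge x 1 with hx | hx
  · rw [ENNReal.tsum_eq_zero.2]
    · exact zero_le
    · intro n
      rw [if_neg]
      rintro ⟨h1, h2⟩
      linarith [one_le_logNorming hα h1]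
  have hlx := logPlus_pos x
  -- The largest first coordinate allowed by norming below `x` when the others are `v`, read off
  -- from `mul_logPlus_le_of_mul_log_lt`.
  set W : (Fin k → ℕ+) → ℝ := fun v =>
    4 * x ^ 2 / logPlus x * (logPlus (tailPow (p - 1) (fun i => α i.succ) v) /
      tailPow (p - 1) (fun i => α i.succ) v) / headProd (p - 1) v with hW
  -- Summing over the first coordinate produces `W v ^ s`, which leaves the remaining head with the
  -- exponent `(s - 1) - s = -1`: harmonic weights there, convergent ones on the tail.
  set w : Fin k → ℕ+ → ℝ≥0∞ := fun i j => if i.val < p - 1 then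
    (if (j : ℝ) ≤ 2 * x ^ 2 then ENNReal.ofReal ((j : ℝ)⁻¹) else 0) else
      ENNReal.ofReal ((j : ℝ) ^ (-e)) with hw
  have hα' : ∀ i : Fin k, p - 1 ≤ i.val → 1 / 2 < α i.succ := fun i hi =>
    hα i.succ (by rw [Fin.val_succ]; omega)
  have hinner : ∀ v : Fin k → ℕ+, ∑' a : ℕ+, (if 1 < headProd p (Fin.cons a v : Fin (k + 1) → ℕ+) ∧
      logNorming p α (Fin.cons a v : Fin (k + 1) → ℕ+) < x then
      ENNReal.ofReal (latticeSize (Fin.cons a v : Fin (k + 1) → ℕ+) ^ (s - 1)) else 0) ≤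
      ENNReal.ofReal ((4 * x ^ 2 / logPlus x) ^ s * K) * ∏ i, w i (v i) := by
    intro v
    have hm := one_le_headProd (p - 1) v
    have hq := one_le_tailProd (p - 1) v
    have hQ := one_le_tailPow hα' v
    have hm0 : 0 < headProd (p - 1) v := by linarith
    have hlQ := logPlus_pos (tailPow (p - 1) (fun i => α i.succ) v)
    by_cases hv : ∀ i : Fin k, i.val < p - 1 → (v i : ℝ) ≤ 2 * x ^ 2
    · have hprod : ∏ i, w i (v i) = ENNReal.ofReal
          ((headProd (p - 1) v)⁻¹ * tailProd (p - 1) v ^ (-e)) := by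
        rw [headProd, tailProd, ← Finset.prod_inv_distrib,
          ← Real.finsetProd_rpow _ _ fun i _ => by positivity,
          ENNReal.ofReal_mul (Finset.prod_nonneg fun i _ => by positivity),
          ENNReal.ofReal_prod_of_nonneg fun i _ => by positivity,
          ENNReal.ofReal_prod_of_nonneg fun i _ => by positivity,
          ← Finset.prod_filter_mul_prod_filter_not Finset.univ (fun i : Fin k => i.val < p - 1)]
        simp only [not_lt]
        congr 1
        · refine Finset.prod_congr rfl fun i hi => ?_
          have hi' := (Finset.mem_filter.1 hi).2
          simp only [hw, if_pos hi', if_pos (hv i hi')]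
        · refine Finset.prod_congr rfl fun i hi => ?_
          have hi' := (Finset.mem_filter.1 hi).2
          simp only [hw, if_neg (not_lt.2 hi')]
      rw [hprod, ← ENNReal.ofReal_mul (by positivity)]
      calc _ ≤ ∑' a : ℕ+, ENNReal.ofReal ((headProd (p - 1) v * tailProd (p - 1) v) ^ (s - 1)) *
            (if (a : ℝ) ≤ W v then ENNReal.ofReal ((a : ℝ) ^ (s - 1)) else 0) := by
            refine ENNReal.tsum_le_tsum fun a => ?_
            split_ifs with h1 h2
            · rw [← headProd_mul_tailProd p, headProd_cons hp, tailProd_cons hp, mul_assoc,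
                mul_comm (a : ℝ), Real.mul_rpow (by positivity) (by positivity),
                ENNReal.ofReal_mul (by positivity)]
            · exfalso
              apply h2
              obtain ⟨h3, h4⟩ := h1
              have h5 := two_le_headProd h3
              have h6 : logNorming p α (Fin.cons a v : Fin (k + 1) → ℕ+) ^ 2 < x ^ 2 :=
                pow_lt_pow_left₀ h4 (logNorming_nonneg _ _ _) two_ne_zero
              rw [logNorming_sq, tailPow_cons hp] at h6
              have h7 := mul_logPlus_le_of_mul_log_lt h5 hQ hx h6
              rw [headProd_cons hp] at h7
              rw [hW]
              simp only
              rw [le_div_iff₀ hm0, div_mul_div_comm, mul_comm (logPlus x), ← div_div,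
                le_div_iff₀ hlx]
              exact h7
            · exact zero_le
            · exact zero_le
        _ ≤ ENNReal.ofReal ((headProd (p - 1) v * tailProd (p - 1) v) ^ (s - 1)) *
            ENNReal.ofReal (W v ^ s) := by
            rw [ENNReal.tsum_mul_left]
            gcongr
            exact tsum_pnat_rpow_le hs _
        _ ≤ _ := by
            rw [← ENNReal.ofReal_mul (by positivity)]
            refine ENNReal.ofReal_le_ofReal ?_
            rw [hW]
            simp only
            rw [Real.div_rpow (by positivity) hm0.le, Real.mul_rpow (by positivity)
              (by positivity), Real.mul_rpow (by positivity) (by positivity)]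
            have e1 : headProd (p - 1) v ^ (s - 1) = headProd (p - 1) v ^ s *
                (headProd (p - 1) v)⁻¹ := by
              rw [Real.rpow_sub_one hm0.ne', div_eq_mul_inv]
            have hms : 0 < headProd (p - 1) v ^ s := by positivity
            rw [e1]
            calc _ = (4 * x ^ 2 / logPlus x) ^ s * (headProd (p - 1) v)⁻¹ *
                  (tailProd (p - 1) v ^ (s - 1) *
                  (logPlus (tailPow (p - 1) (fun i => α i.succ) v) /
                    tailPow (p - 1) (fun i => α i.succ) v) ^ s) := by
                  field_simp
              _ ≤ (4 * x ^ 2 / logPlus x) ^ s * (headProd (p - 1) v)⁻¹ *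
                  (K * tailProd (p - 1) v ^ (-e)) := by
                  exact mul_le_mul_of_nonneg_left (hKv v) (by positivity)
              _ = _ := by ring
    · push Not at hv
      obtain ⟨i, hi, hvi⟩ := hv
      rw [ENNReal.tsum_eq_zero.2]
      · exact zero_le
      · intro a
        rw [if_neg]
        rintro ⟨h1, h2⟩
        have h3 := headProd_le_sq hα h1
        have h4 : logNorming p α (Fin.cons a v : Fin (k + 1) → ℕ+) ^ 2 < x ^ 2 :=
          pow_lt_pow_left₀ h2 (logNorming_nonneg _ _ _) two_ne_zero
        have h5 : ((Fin.cons a v : Fin (k + 1) → ℕ+) i.succ : ℝ) ≤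
            headProd p (Fin.cons a v : Fin (k + 1) → ℕ+) :=
          le_headProd (by rw [Fin.val_succ]; omega)
        rw [Fin.cons_succ] at h5
        linarith
  have hfac : ∀ i : Fin k, ∑' j, w i j ≤ if i.val < p - 1 then ENNReal.ofReal (4 * logPlus x) else
      ENNReal.ofReal Z := by
    intro i
    simp only [hw]
    split_ifs with hi
    · exact tsum_pnat_inv_le hx
    · exact hZt
  calc _ ≤ ∑' v : Fin k → ℕ+, ENNReal.ofReal ((4 * x ^ 2 / logPlus x) ^ s * K) *
        ∏ i, w i (v i) := by
        rw [tsum_pi_succ]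
        exact ENNReal.tsum_le_tsum hinner
    _ ≤ ENNReal.ofReal ((4 * x ^ 2 / logPlus x) ^ s * K) * ∏ i : Fin k,
        (if i.val < p - 1 then ENNReal.ofReal (4 * logPlus x) else ENNReal.ofReal Z) := by
        rw [ENNReal.tsum_mul_left]
        gcongr
        exact (ENNReal.tsum_pi_prod_le w).trans (Finset.prod_le_prod' fun i _ => hfac i)
    _ = ENNReal.ofReal ((4 * x ^ 2 / logPlus x) ^ s * K * ((4 * logPlus x) ^ (p - 1) * Z ^ T)) := by
        rw [Finset.prod_ite, Finset.prod_const, Finset.prod_const, hcard,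
          ← ENNReal.ofReal_pow (by positivity), ← ENNReal.ofReal_pow (by positivity),
          ← ENNReal.ofReal_mul (by positivity), ← ENNReal.ofReal_mul (by positivity)]
        simp only [not_lt, T]
    _ = _ := by
        congr 1
        have e1 : logPlus x ^ ((p : ℝ) - 1 - s) = logPlus x ^ (p - 1) / logPlus x ^ s := by
          rw [Real.rpow_sub hlx, ← Real.rpow_natCast, Nat.cast_sub hp, Nat.cast_one]
        have e2 : x ^ (2 * s) = (x ^ 2) ^ s := by
          rw [Real.rpow_mul (by linarith)]
          norm_num
        rw [e1, e2, Real.div_rpow (by positivity) hlx.le, Real.mul_rpow (by norm_num)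
          (by positivity), mul_pow]
        ring

end Count

/-! ### Summable weights on the lattice; moments and tails of `ξ` -/

section Summability

theorem summable_pi_prod {ι β : Type*} [Fintype ι] {w : ι → β → ℝ} (hw : ∀ i j, 0 ≤ w i j)
    (h : ∀ i, Summable (w i)) : Summable fun v : ι → β => ∏ i, w i (v i) := by
  have h1 : ∑' v : ι → β, ENNReal.ofReal (∏ i, w i (v i)) ≠ ∞ := by
    simp_rw [ENNReal.ofReal_prod_of_nonneg fun i _ => hw i _]
    refine ne_top_of_le_ne_top ?_ (ENNReal.tsum_pi_prod_le fun i j => ENNReal.ofReal (w i j))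
    exact ENNReal.prod_ne_top fun i _ => (h i).tsum_ofReal_ne_top
  refine (ENNReal.summable_toReal h1).congr fun v => ?_
  exact ENNReal.toReal_ofReal (Finset.prod_nonneg fun i _ => hw i _)

theorem summable_latticeSize_rpow {d : ℕ} {e : ℝ} (he : e < -1) :
    Summable fun n : Fin d → ℕ+ => latticeSize n ^ e := by
  have h1 : Summable fun a : ℕ+ => (a : ℝ) ^ e :=
    (Real.summable_nat_rpow.2 he).comp_injective PNat.coe_injective
  refine (summable_pi_prod (w := fun _ (a : ℕ+) => (a : ℝ) ^ e) (fun _ _ => by positivity)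
    fun _ : Fin d => h1).congr fun n => ?_
  exact Real.finsetProd_rpow _ _ (fun _ _ => by positivity) _

theorem summable_inv_mul_logPlus : Summable fun a : ℕ => (a : ℝ)⁻¹ * logPlus a ^ (-2 : ℝ) := by
  rw [← summable_condensed_iff_of_nonneg (fun n => mul_nonneg (by positivity)
    (Real.rpow_nonneg (logPlus_pos _).le _))]
  · have h1 : Summable fun k : ℕ => (Real.log 2) ^ (-2 : ℝ) * (k : ℝ) ^ (-2 : ℝ) :=
      (Real.summable_nat_rpow.2 (by norm_num)).mul_left _
    rw [← summable_nat_add_iff 1] at h1 ⊢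
    refine Summable.of_nonneg_of_le (fun k => ?_) (fun k => ?_) h1
    · exact mul_nonneg (by positivity) (mul_nonneg (by positivity)
        (Real.rpow_nonneg (logPlus_pos _).le _))
    · have hl : 0 < Real.log 2 := Real.log_pos (by norm_num)
      push_cast
      rw [mul_inv_cancel_left₀ (by positivity), ← Real.mul_rpow hl.le (by positivity)]
      refine Real.rpow_le_rpow_of_nonpos (by positivity) ?_ (by norm_num)
      refine le_trans (le_of_eq ?_) (log_le_logPlus _)
      rw [Real.log_pow]
      push_cast
      ring
  · intro m n hm hmn
    have hm' : (1 : ℝ) ≤ m := Nat.one_le_cast.2 hm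
    have hmn' : (m : ℝ) ≤ n := by exact_mod_cast hmn
    refine mul_le_mul (inv_anti₀ (by linarith) hmn') ?_ (Real.rpow_nonneg (logPlus_pos _).le _)
      (by positivity)
    exact Real.rpow_le_rpow_of_nonpos (logPlus_pos _) (logPlus_le_logPlus hm' hmn') (by norm_num)

/-- Since `latticeSize n` dominates each coordinate, the exponent `-2d` can be shared out as `-2`
per coordinate, and the series is then dominated by a product of convergent ones. -/
theorem summable_latticeSize_logPlus (d : ℕ) :
    Summable fun n : Fin d → ℕ+ =>
      (latticeSize n)⁻¹ * logPlus (latticeSize n) ^ (-(2 * d) : ℝ) := by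
  have h1 : Summable fun a : ℕ+ => (a : ℝ)⁻¹ * logPlus a ^ (-2 : ℝ) :=
    summable_inv_mul_logPlus.comp_injective PNat.coe_injective
  refine Summable.of_nonneg_of_le (fun n => ?_) (fun n => ?_)
    (summable_pi_prod (w := fun _ (a : ℕ+) => (a : ℝ)⁻¹ * logPlus a ^ (-2 : ℝ))
    (fun _ _ => mul_nonneg (by positivity) (Real.rpow_nonneg (logPlus_pos _).le _))
    fun _ : Fin d => h1)
  · exact mul_nonneg (inv_nonneg.2 (latticeSize_pos n).le) (Real.rpow_nonneg (logPlus_pos _).le _)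
  · rw [Finset.prod_mul_distrib, Finset.prod_inv_distrib]
    refine mul_le_mul_of_nonneg_left ?_ (inv_nonneg.2 (latticeSize_pos n).le)
    have e1 : logPlus (latticeSize n) ^ (-(2 * d) : ℝ) =
        ∏ _i : Fin d, logPlus (latticeSize n) ^ (-2 : ℝ) := by
      rw [Finset.prod_const, Finset.card_univ, Fintype.card_fin, ← Real.rpow_mul_natCast
        (logPlus_pos _).le]
      congr 1; ring
    rw [e1]
    refine Finset.prod_le_prod (fun _ _ => Real.rpow_nonneg (logPlus_pos _).le _) fun i _ => ?_
    exact Real.rpow_le_rpow_of_nonpos (logPlus_pos _)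
      (logPlus_le_logPlus (Nat.one_le_cast.2 (PNat.pos (n i))) (le_latticeSize n i)) (by norm_num)

variable {Ω : Type*} [MeasurableSpace Ω]

/-- The moment condition makes the weighted tail probabilities summable. -/
theorem LogMomentFinite.summable_tail {d p : ℕ} (hp : 1 ≤ p) (hpd : p ≤ d) {α : Fin d → ℝ}
    (hα : ∀ i : Fin d, p ≤ i.val → 1 / 2 < α i) {r : ℝ} (hr : 2 ≤ r) {ξ : Ω → ℝ} {Q : Measure Ω}
    [IsProbabilityMeasure Q] (hξ : Measurable ξ) (h : LogMomentFinite ξ Q r p) {c : ℝ}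
    (hc : 0 < c) :
    Summable fun n : {n : Fin d → ℕ+ // 1 < headProd p n} =>
      latticeSize n.1 ^ (r / 2 - 1) * Q.real {ω | c * logNorming p α n.1 < |ξ ω|} := by
  obtain ⟨k, rfl⟩ : ∃ k, d = k + 1 := ⟨d - 1, by omega⟩
  obtain ⟨C, hC, hCx⟩ := exists_count_le hp hpd hα (s := r / 2) (by linarith)
  have h' := h.const_mul hξ (inv_pos.2 hc)
  have hset : ∀ n : Fin (k + 1) → ℕ+, {ω | c * logNorming p α n < |ξ ω|} =
      {ω | logNorming p α n < |c⁻¹ * ξ ω|} := by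
    intro n
    ext ω
    simp only [Set.mem_ofPred_eq]
    rw [abs_mul, abs_of_pos (inv_pos.2 hc), lt_inv_mul_iff₀ hc]
  have hms : ∀ n : Fin (k + 1) → ℕ+, MeasurableSet {ω | logNorming p α n < |c⁻¹ * ξ ω|} :=
    fun n => measurableSet_lt measurable_const (hξ.const_mul _).abs
  have hfin : ∑' n : Fin (k + 1) → ℕ+, (if 1 < headProd p n then
      ENNReal.ofReal (latticeSize n ^ (r / 2 - 1)) * Q {ω | logNorming p α n < |c⁻¹ * ξ ω|}
      else 0) ≠ ∞ := by
    have e : ∀ n : Fin (k + 1) → ℕ+, (if 1 < headProd p n then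
        ENNReal.ofReal (latticeSize n ^ (r / 2 - 1)) * Q {ω | logNorming p α n < |c⁻¹ * ξ ω|}
        else 0) = ∫⁻ ω, (if 1 < headProd p n ∧ logNorming p α n < |c⁻¹ * ξ ω| then
          ENNReal.ofReal (latticeSize n ^ (r / 2 - 1)) else 0) ∂Q := by
      intro n
      by_cases hn : 1 < headProd p n
      · simp only [hn, true_and, if_true]
        rw [← lintegral_indicator_const (hms n)]
        rfl
      · simp [hn]
    -- By Tonelli the series is the expectation of the weighted count at the level `|c⁻¹ * ξ|`.
    rw [tsum_congr e, ← lintegral_tsum]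
    · refine ne_top_of_le_ne_top ?_ (lintegral_mono fun ω => hCx |c⁻¹ * ξ ω| (abs_nonneg _))
      have h2 := (Integrable.const_mul h' C).lintegral_lt_top
      rw [show 2 * (r / 2) = r by ring]
      exact h2.ne
    · intro n
      by_cases hn : 1 < headProd p n
      · simp only [hn, true_and]
        exact (Measurable.ite (hms n) measurable_const measurable_const).aemeasurable
      · simp [hn]
  refine ((ENNReal.summable_toReal hfin).comp_injective Subtype.val_injective).congr fun n => ?_
  simp only [Function.comp_apply, if_pos n.2]
  rw [ENNReal.toReal_mul, ENNReal.toReal_ofReal (Real.rpow_nonneg (latticeSize_pos _).le _),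
    hset, measureReal_def]

/-- All lower moments are finite. -/
theorem LogMomentFinite.exists_measureReal_le {p : ℕ} {r r' : ℝ} (hr' : 0 < r') (hrr : r' < r)
    {ξ : Ω → ℝ} {Q : Measure Ω} [IsProbabilityMeasure Q] (hξ : Measurable ξ)
    (h : LogMomentFinite ξ Q r p) :
    ∃ C : ℝ, 0 < C ∧ ∀ b : ℝ, 0 < b → Q.real {ω | b < |ξ ω|} ≤ C * b ^ (-r') := by
  set β := (p : ℝ) - 1 - r / 2 with hβ
  obtain ⟨K, hK, hKx⟩ := exists_logPlus_rpow_le (abs_nonneg β) (sub_pos.2 hrr)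
  have hpt : ∀ x : ℝ, 0 ≤ x → x ^ r' ≤ 1 + K * (x ^ r * logPlus x ^ β) := by
    intro x hx
    have hl := logPlus_pos x
    have h0 : 0 ≤ K * (x ^ r * logPlus x ^ β) := by positivity
    rcases le_or_gt x 1 with h1 | h1
    · have := Real.rpow_le_one hx h1 hr'.le
      linarith
    · have h2 := hKx x h1.le
      have hx0 : 0 < x := by linarith
      have h3 : logPlus x ^ (-|β|) ≤ logPlus x ^ β :=
        Real.rpow_le_rpow_of_exponent_le (one_le_logPlus x) (neg_abs_le β)
      have h4 : x ^ r' * logPlus x ^ |β| ≤ K * x ^ r := by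
        calc x ^ r' * logPlus x ^ |β| ≤ x ^ r' * (K * x ^ (r - r')) := by gcongr
          _ = K * x ^ r := by rw [mul_left_comm, ← Real.rpow_add hx0]; congr 2; ring
      have h5 : x ^ r' ≤ K * x ^ r * logPlus x ^ (-|β|) := by
        rw [Real.rpow_neg hl.le, ← div_eq_mul_inv, le_div_iff₀ (by positivity)]
        exact h4
      have h6 : K * x ^ r * logPlus x ^ (-|β|) ≤ K * x ^ r * logPlus x ^ β := by gcongr
      linarith
  have hint : Integrable (fun ω => |ξ ω| ^ r') Q := by
    refine Integrable.mono' ((integrable_const 1).add (Integrable.const_mul h K))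
      (hξ.abs.pow_const r').aestronglyMeasurable (Eventually.of_forall fun ω => ?_)
    rw [Real.norm_of_nonneg (by positivity)]
    exact hpt _ (abs_nonneg _)
  have hI : 0 ≤ ∫ ω, |ξ ω| ^ r' ∂Q := integral_nonneg fun _ => by positivity
  refine ⟨∫ ω, |ξ ω| ^ r' ∂Q + 1, by linarith, fun b hb => ?_⟩
  have h1 := mul_meas_ge_le_integral_of_nonneg
    (Eventually.of_forall fun ω => by positivity) hint (b ^ r')
  have h2 : Q.real {ω | b < |ξ ω|} ≤ Q.real {ω | b ^ r' ≤ |ξ ω| ^ r'} :=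
    measureReal_mono fun ω (hω : b < |ξ ω|) => Real.rpow_le_rpow hb.le hω.le hr'.le
  rw [Real.rpow_neg hb.le, ← div_eq_mul_inv, le_div_iff₀' (by positivity)]
  have h3 : 0 < b ^ r' := by positivity
  nlinarith

theorem measureReal_lt_abs_le {ξ : Ω → ℝ} {Q : Measure Ω} [IsProbabilityMeasure Q]
    (hint : Integrable (fun ω => ξ ω ^ 2) Q) {b : ℝ} (hb : 0 < b) :
    Q.real {ω | b < |ξ ω|} ≤ (∫ ω, ξ ω ^ 2 ∂Q) / b ^ 2 := by
  have h1 := mul_meas_ge_le_integral_of_nonneg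
    (Eventually.of_forall fun ω => sq_nonneg (ξ ω)) hint (b ^ 2)
  have h2 : Q.real {ω | b < |ξ ω|} ≤ Q.real {ω | b ^ 2 ≤ ξ ω ^ 2} :=
    measureReal_mono fun ω (hω : b < |ξ ω|) => by
      rw [Set.mem_ofPred_eq, ← sq_abs (ξ ω)]
      exact pow_le_pow_left₀ hb.le hω.le 2
  rw [le_div_iff₀' (by positivity)]
  have h3 : 0 < b ^ 2 := by positivity
  nlinarith

end Summability

/-- For all but finitely many lattice points the norming dominates `√(|n| log |n|)`. -/
theorem exists_mul_log_le_logNorming_sq {d p : ℕ} {α : Fin d → ℝ}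
    (hα : ∀ i : Fin d, p ≤ i.val → 1 / 2 < α i) :
    ∃ N₀ : ℝ, ∀ n : Fin d → ℕ+, 1 < headProd p n → N₀ ≤ latticeSize n →
      latticeSize n * Real.log (latticeSize n) ≤ logNorming p α n ^ 2 := by
  obtain ⟨γ, hγ, hγα⟩ := exists_gap hα
  -- Beyond this threshold `log h ≥ 1 / γ` or `log q ≥ 4 / γ ^ 2`. Either one, the second with `log
  -- h ≥ 1 / 2`, gives `log h * (γ + γ ^ 2 * log q / 2) ≥ 1`, and so `log h + log q ≤ log h * q ^
  -- γ`.
  refine ⟨Real.exp (1 / γ + 4 / γ ^ 2), fun n hn hN => ?_⟩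
  rw [logNorming_sq]
  have hh := two_le_headProd hn
  have hq := one_le_tailProd p n
  have hQ := tailProd_rpow_le_tailPow hγα n
  have hlog2 := Real.log_two_gt_d9
  rw [← headProd_mul_tailProd p n] at hN ⊢
  set h := headProd p n
  set q := tailProd p n
  have hq0 : 0 < q := by linarith
  have hh0 : 0 < h := by linarith
  have hlh : 1 / 2 ≤ Real.log h := by
    have := Real.log_le_log (by norm_num) hh
    linarith
  have hlq : 0 ≤ Real.log q := Real.log_nonneg hq
  have hlN : 1 / γ + 4 / γ ^ 2 ≤ Real.log h + Real.log q := by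
    rw [← Real.log_mul hh0.ne' hq0.ne']
    exact (Real.le_log_iff_exp_le (by positivity)).2 hN
  have h1 : 1 + γ * Real.log q + (γ * Real.log q) ^ 2 / 2 ≤ q ^ γ := by
    have := Real.quadratic_le_exp_of_nonneg (mul_nonneg hγ.le hlq)
    rwa [Real.rpow_def_of_pos hq0, mul_comm (Real.log q)]
  have h2 : Real.log q ≤ Real.log h * (γ * Real.log q + (γ * Real.log q) ^ 2 / 2) := by
    have h3 : 1 ≤ Real.log h * (γ + γ ^ 2 * Real.log q / 2) := by
      rcases le_total (1 / γ) (Real.log h) with h4 | h4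
      · have h5 : 1 ≤ Real.log h * γ := by rwa [div_le_iff₀ hγ] at h4
        have h6 : 0 ≤ Real.log h * (γ ^ 2 * Real.log q / 2) := by positivity
        linarith
      · have h5 : 4 / γ ^ 2 ≤ Real.log q := by linarith
        have h6 : 4 ≤ γ ^ 2 * Real.log q := by rwa [div_le_iff₀' (by positivity)] at h5
        nlinarith
    nlinarith
  have h3 : Real.log h + Real.log q ≤ Real.log h * q ^ γ := by nlinarith
  calc h * q * Real.log (h * q) = h * q * (Real.log h + Real.log q) := by
        rw [Real.log_mul hh0.ne' hq0.ne']
    _ ≤ h * q * (Real.log h * q ^ γ) := by gcongr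
    _ = h * Real.log h * q ^ (1 + γ) := by
        rw [Real.rpow_add hq0, Real.rpow_one]; ring
    _ ≤ _ := by
        have : 0 ≤ h * Real.log h := by positivity
        gcongr

/-! ### The direct half -/

section DirectHalf

variable {d : ℕ} {Ω Ω' : Type*} [MeasurableSpace Ω] [MeasurableSpace Ω']
  {X : (Fin d → ℕ+) → Ω → ℝ} {P : Measure Ω} [IsProbabilityMeasure P] {ξ : Ω' → ℝ}
  {Q : Measure Ω'} [IsProbabilityMeasure Q] {κ₁ κ₂ : ℝ} {n₀ : Fin d → ℕ+} {x₀ : ℝ}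

theorem NegativelyDependent.measureReal_abs_partialSum_le (hX_nd : NegativelyDependent X P)
    (hX : ∀ k, Measurable (X k)) (hξ : Measurable ξ) (hX_int : ∀ k, Integrable (X k) P)
    (hX_mean : ∀ k, ∫ ω, X k ω ∂P = 0) (h : WeaklyMeanBounded X P ξ Q κ₁ κ₂ n₀ x₀) {σ : ℝ}
    (hint : Integrable (fun ω => ξ ω ^ 2) Q) (hσ : ∫ ω, ξ ω ^ 2 ∂Q = σ ^ 2) {t b y : ℝ}
    (ht : 0 < t) (hb : x₀ < b) (hy : x₀ < y) (x : ℝ) (n : Fin d → ℕ+) :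
    P.real {ω | x ≤ |partialSum X n ω|} ≤
      2 * (latticeSize n * latticeSize n₀ * κ₁ * Q.real {ω | y < |ξ ω|} +
        Real.exp (-(t * x) + (t ^ 2 / 2 * Real.exp (t * b) *
          (latticeSize n * sigmaOneSq κ₁ n₀ x₀ σ) + Real.exp (t * y) *
          (latticeSize n * latticeSize n₀ * κ₁ * Q.real {ω | b < |ξ ω|})))) := by
  have hb0 : 0 ≤ b := h.threshold_nonneg.trans hb.le
  have hy0 : 0 ≤ y := h.threshold_nonneg.trans hy.le
  have key : ∀ Y : (Fin d → ℕ+) → Ω → ℝ, NegativelyDependent Y P → (∀ k, Measurable (Y k)) →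
      (∀ k, Integrable (Y k) P) → (∀ k, ∫ ω, Y k ω ∂P = 0) →
      WeaklyMeanBounded Y P ξ Q κ₁ κ₂ n₀ x₀ →
      P.real {ω | x ≤ ∑ k ∈ Finset.Iic n, Y k ω} ≤
        latticeSize n * latticeSize n₀ * κ₁ * Q.real {ω | y < |ξ ω|} +
        Real.exp (-(t * x) + (t ^ 2 / 2 * Real.exp (t * b) *
          (latticeSize n * sigmaOneSq κ₁ n₀ x₀ σ) + Real.exp (t * y) *
          (latticeSize n * latticeSize n₀ * κ₁ * Q.real {ω | b < |ξ ω|}))) := by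
    intro Y hnd hY hYi hYm hY'
    have hs : ∀ z, x₀ < z → ∑ k ∈ Finset.Iic n, P.real {ω | z < Y k ω} ≤
        latticeSize n * latticeSize n₀ * κ₁ * Q.real {ω | z < |ξ ω|} := fun z hz =>
      (Finset.sum_le_sum fun k _ => measureReal_mono fun ω (hω : z < Y k ω) =>
        hω.trans_le (le_abs_self _)).trans (hY'.sum_le hz n)
    refine (hnd.measureReal_le_sum_le hY hYi hYm (hY'.integrable_sq hY hξ hint) ht hb0 hy0 x
      (Finset.Iic n)).trans (add_le_add (hs y hy) (Real.exp_le_exp.2 ?_))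
    gcongr
    · exact hY'.sum_integral_sq_le hY hξ hint hσ n
    · exact hs b hb
  have h1 := key X hX_nd hX hX_int hX_mean h
  have h2 := key (fun k ω => -X k ω) (hX_nd.neg hX) (fun k => (hX k).neg)
    (fun k => (hX_int k).neg) (fun k => by rw [integral_neg, hX_mean k, neg_zero]) h.neg
  have h3 : P.real {ω | x ≤ |partialSum X n ω|} ≤ P.real {ω | x ≤ ∑ k ∈ Finset.Iic n, X k ω} +
      P.real {ω | x ≤ ∑ k ∈ Finset.Iic n, -X k ω} := by
    refine le_trans (measureReal_mono ?_) (measureReal_union_le _ _)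
    intro ω hω
    simpa [partialSum, le_abs, Finset.sum_neg_distrib] using hω
  linarith

/-- Collects what "`N` large" has to mean for `r > 2`. The last condition keeps `t * b` small for `b
= N ^ β` and `t` at most `τ * log N / (ε * √N)`. -/
theorem eventually_large_of_gap {τ ε η x₀ δ β : ℝ} (hη : 0 < η) (hδ : 0 < δ) (hβ0 : 0 < β)
    (hβ : β < 1 / 2) :
    ∀ᶠ N : ℝ in atTop, 1 ≤ N ∧ 1 ≤ Real.log N ∧ x₀ < N ^ β ∧ x₀ < δ * Real.sqrt N ∧
      τ / ε * (Real.log N * N ^ (β - 1 / 2)) ≤ η := by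
  have h1 : Tendsto (fun N : ℝ => τ / ε * (Real.log N * N ^ (β - 1 / 2))) atTop (𝓝 0) := by
    have h2 := (isLittleO_log_rpow_atTop (show 0 < 1 / 2 - β by linarith)).tendsto_div_nhds_zero
    have h3 := h2.const_mul (τ / ε)
    rw [mul_zero] at h3
    refine h3.congr' ?_
    filter_upwards [eventually_gt_atTop 0] with N hN
    rw [show β - 1 / 2 = -(1 / 2 - β) by ring, Real.rpow_neg hN.le, div_eq_mul_inv (Real.log N)]
  filter_upwards [eventually_ge_atTop 1, Real.tendsto_log_atTop.eventually_ge_atTop 1,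
    (tendsto_rpow_atTop hβ0).eventually_gt_atTop x₀,
    (Real.tendsto_sqrt_atTop.const_mul_atTop hδ).eventually_gt_atTop x₀,
    h1.eventually_le_const hη] with N a b c e f
  exact ⟨a, b, c, e, f⟩

/-- The basic estimate for `r > 2`. -/
theorem NegativelyDependent.exists_bound_of_two_lt (hX_nd : NegativelyDependent X P)
    (hX : ∀ k, Measurable (X k)) (hξ : Measurable ξ) (hX_int : ∀ k, Integrable (X k) P)
    (hX_mean : ∀ k, ∫ ω, X k ω ∂P = 0) (h : WeaklyMeanBounded X P ξ Q κ₁ κ₂ n₀ x₀) {σ : ℝ}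
    (hint : Integrable (fun ω => ξ ω ^ 2) Q) (hσ : ∫ ω, ξ ω ^ 2 ∂Q = σ ^ 2) {p : ℕ}
    {α : Fin d → ℝ} (hα : ∀ i : Fin d, p ≤ i.val → 1 / 2 < α i) {r : ℝ} (hr : 2 < r)
    (hmom : LogMomentFinite ξ Q r p) {ε τ : ℝ} (hε : 0 < ε) (hτ : r - 2 < τ)
    (hτσ : τ * sigmaOneSq κ₁ n₀ x₀ σ ≤ ε ^ 2) :
    ∃ δ C θ N₁ : ℝ, 0 < δ ∧ (r - 2) / 2 < θ ∧ ∀ n : Fin d → ℕ+, 1 < headProd p n →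
      N₁ ≤ latticeSize n → P.real {ω | logNorming p α n * ε ≤ |partialSum X n ω|} ≤
        2 * (latticeSize n * latticeSize n₀ * κ₁ * Q.real {ω | δ * logNorming p α n < |ξ ω|} +
          C * latticeSize n ^ (-θ)) := by
  have hτ0 : 0 < τ := by linarith
  have hκ := h.pos_left
  have hn₀ := latticeSize_pos n₀
  obtain ⟨r', hr2, hrr⟩ := exists_between hr
  obtain ⟨C₀, hC₀, hC₀b⟩ := hmom.exists_measureReal_le (by linarith) hrr hξ
  -- The level is `b = N ^ β`. With `β < 1 / 2` the product `t * b` tends to 0; with `β * r' > 1`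
  -- the expected number of exceedances of `b` is at most of order `N ^ (1 - β * r')`, a negative
  -- power.
  set β := (1 / 2 + 1 / r') / 2 with hβ
  have hr'0 : 0 < r' := by linarith
  have hr'i : 1 / r' < 1 / 2 := one_div_lt_one_div_of_lt (by norm_num) hr2
  have hβ2 : β < 1 / 2 := by rw [hβ]; linarith
  have hβ0 : 0 < β := by positivity
  have hβr : 1 < β * r' := by
    have : β * r' = r' / 4 + 1 / 2 := by rw [hβ]; field_simp; ring
    linarith
  -- For the `t` used below, `exp (t * (δ * a)) = N ^ (β * r' - 1)`, which cancels exactly the bound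
  -- on the number of exceedances of `b`.
  set δ := ε * (β * r' - 1) / τ with hδ
  have hδ0 : 0 < δ := div_pos (mul_pos hε (by linarith)) hτ0
  set η' := (τ - (r - 2)) / (2 * τ) with hη'
  have hη'0 : 0 < η' := div_pos (by linarith) (by linarith)
  obtain ⟨N₀, hN₀⟩ := exists_mul_log_le_logNorming_sq hα
  obtain ⟨N₁, hN₁⟩ := eventually_atTop.1 (eventually_large_of_gap (τ := τ) (ε := ε) (x₀ := x₀)
    (Real.log_pos (show 1 < 1 + η' by linarith)) hδ0 hβ0 hβ2)
  set K₀ := latticeSize n₀ * κ₁ with hK₀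
  -- The final exponent is at most `-τ L + (τ L / 2) * (1 + η') + K₀ * C₀`; by the choice of `η'`
  -- its coefficient of `L` is `-(τ + (r - 2)) / 4`, which is below `-(r - 2) / 2`.
  refine ⟨δ, Real.exp (K₀ * C₀), (τ + (r - 2)) / 4, max N₀ N₁, hδ0, by linarith,
    fun n hn hN => ?_⟩
  obtain ⟨h1, hL1, hbx, hyx, hbη⟩ := hN₁ (latticeSize n) ((le_max_right _ _).trans hN)
  have ha2 := hN₀ n hn ((le_max_left _ _).trans hN)
  have ha0 := logNorming_nonneg p α n
  set a := logNorming p α n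
  set N := latticeSize n
  set L := Real.log N with hL
  have hNpos : 0 < N := by linarith
  have haN : Real.sqrt N ≤ a := Real.sqrt_le_iff.2 ⟨ha0, by nlinarith⟩
  have ha : 0 < a := (Real.sqrt_pos.2 hNpos).trans_le haN
  -- In the extreme case `a² = N L`, `τ σ₁² = ε²`, this value of `t` minimises `-t ε a + t² N σ₁² /
  -- 2`.
  have ht : 0 < τ * L / (ε * a) := by positivity
  refine (hX_nd.measureReal_abs_partialSum_le hX hξ hX_int hX_mean h hint hσ ht hbx
    (hyx.trans_le (mul_le_mul_of_nonneg_left haN hδ0.le)) (a * ε) n).trans ?_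
  gcongr
  set t := τ * L / (ε * a) with htdef
  have hs0 : 0 ≤ sigmaOneSq κ₁ n₀ x₀ σ := by unfold sigmaOneSq; positivity
  have e1 : t * (a * ε) = τ * L := by rw [htdef]; field_simp
  have e2 : t ^ 2 * (N * sigmaOneSq κ₁ n₀ x₀ σ) ≤ τ * L := by
    rw [htdef, div_pow, div_mul_eq_mul_div, div_le_iff₀ (by positivity)]
    calc (τ * L) ^ 2 * (N * sigmaOneSq κ₁ n₀ x₀ σ) =
          τ * L * (N * L) * (τ * sigmaOneSq κ₁ n₀ x₀ σ) := by ring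
      _ ≤ τ * L * a ^ 2 * ε ^ 2 := by gcongr
      _ = τ * L * (ε * a) ^ 2 := by ring
  have e3 : Real.exp (t * N ^ β) ≤ 1 + η' := by
    rw [← Real.le_log_iff_exp_le (by linarith)]
    refine le_trans ?_ hbη
    rw [htdef, Real.rpow_sub hNpos, ← Real.sqrt_eq_rpow]
    calc τ * L / (ε * a) * N ^ β ≤ τ * L / (ε * Real.sqrt N) * N ^ β := by
          have := Real.sqrt_pos.2 hNpos
          gcongr
      _ = _ := by ring
  have e4 : Real.exp (t * (δ * a)) * (N * latticeSize n₀ * κ₁ * Q.real {ω | N ^ β < |ξ ω|}) ≤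
      K₀ * C₀ := by
    have e5 : t * (δ * a) = Real.log N * (β * r' - 1) := by
      rw [htdef, hδ, hL]; field_simp
    rw [e5, ← Real.rpow_def_of_pos hNpos]
    calc N ^ (β * r' - 1) * (N * latticeSize n₀ * κ₁ * Q.real {ω | N ^ β < |ξ ω|})
        ≤ N ^ (β * r' - 1) * (N * latticeSize n₀ * κ₁ * (C₀ * (N ^ β) ^ (-r'))) := by
          gcongr
          exact hC₀b _ (by positivity)
      _ = K₀ * C₀ * (N ^ (β * r' - 1) * N * (N ^ β) ^ (-r')) := by rw [hK₀]; ring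
      _ = K₀ * C₀ := by
          rw [← Real.rpow_mul hNpos.le, ← Real.rpow_add_one hNpos.ne', ← Real.rpow_add hNpos,
            show β * r' - 1 + 1 + β * -r' = 0 by ring, Real.rpow_zero, mul_one]
  rw [Real.rpow_def_of_pos hNpos (-_), ← Real.exp_add, ← hL]
  refine Real.exp_le_exp.2 ?_
  have e6 : t ^ 2 / 2 * Real.exp (t * N ^ β) * (N * sigmaOneSq κ₁ n₀ x₀ σ) ≤
      τ * L / 2 * (1 + η') := by
    calc _ = t ^ 2 * (N * sigmaOneSq κ₁ n₀ x₀ σ) / 2 * Real.exp (t * N ^ β) := by ring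
      _ ≤ _ := by gcongr
  have e7 : τ * L / 2 * (1 + η') = τ * L - L * ((τ + (r - 2)) / 4) := by
    rw [hη']; field_simp; ring
  rw [e1]
  linarith

/-- The basic estimate for `r = 2`. -/
theorem NegativelyDependent.exists_bound_of_integrable_sq (hd : 0 < d)
    (hX_nd : NegativelyDependent X P)
    (hX : ∀ k, Measurable (X k)) (hξ : Measurable ξ) (hX_int : ∀ k, Integrable (X k) P)
    (hX_mean : ∀ k, ∫ ω, X k ω ∂P = 0) (h : WeaklyMeanBounded X P ξ Q κ₁ κ₂ n₀ x₀) {σ : ℝ}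
    (hint : Integrable (fun ω => ξ ω ^ 2) Q) (hσ : ∫ ω, ξ ω ^ 2 ∂Q = σ ^ 2) {p : ℕ}
    {α : Fin d → ℝ} (hα : ∀ i : Fin d, p ≤ i.val → 1 / 2 < α i) {ε : ℝ} (hε : 0 < ε) :
    ∃ δ C N₁ : ℝ, 0 < δ ∧ ∀ n : Fin d → ℕ+, 1 < headProd p n →
      N₁ ≤ latticeSize n → P.real {ω | logNorming p α n * ε ≤ |partialSum X n ω|} ≤
        2 * (latticeSize n * latticeSize n₀ * κ₁ * Q.real {ω | δ * logNorming p α n < |ξ ω|} +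
          C * logPlus (latticeSize n) ^ (-(2 * d) : ℝ)) := by
  have hκ := h.pos_left
  have hn₀ := latticeSize_pos n₀
  -- The target exponent of the logarithm, as required by `summable_latticeSize_logPlus`.
  set M : ℝ := 2 * d with hM
  have hM0 : 0 < M := by positivity
  -- Makes `exp (t * (δ * a)) = √L` for `t = M * log L / (ε * a)`. Both truncation levels are `δ *
  -- a`.
  set δ := ε / (2 * M) with hδ
  have hδ0 : 0 < δ := by positivity
  obtain ⟨N₀, hN₀⟩ := exists_mul_log_le_logNorming_sq hα
  have hev : ∀ᶠ N : ℝ in atTop, 1 ≤ N ∧ 1 < Real.log N ∧ x₀ < δ * Real.sqrt N := by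
    filter_upwards [eventually_ge_atTop 1, Real.tendsto_log_atTop.eventually_gt_atTop 1,
      (Real.tendsto_sqrt_atTop.const_mul_atTop hδ0).eventually_gt_atTop x₀] with N a b c
    exact ⟨a, b, c⟩
  obtain ⟨N₁, hN₁⟩ := eventually_atTop.1 hev
  set K₀ := latticeSize n₀ * κ₁ with hK₀
  have hs0 : 0 ≤ sigmaOneSq κ₁ n₀ x₀ σ := by unfold sigmaOneSq; positivity
  set s₁ := sigmaOneSq κ₁ n₀ x₀ σ
  -- The factor `exp (-t ε a)` is `L ^ (-M)`. The rest of the exponent stays bounded: `(log L)² ≤ 16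
  -- √L` and `N L ≤ a²` handle the quadratic term, Chebyshev's inequality the exceedances.
  refine ⟨δ, Real.exp (8 * M ^ 2 * s₁ / ε ^ 2 + K₀ * σ ^ 2 / δ ^ 2), max N₀ N₁, hδ0,
    fun n hn hN => ?_⟩
  obtain ⟨h1, hL1, hyx⟩ := hN₁ (latticeSize n) ((le_max_right _ _).trans hN)
  have ha2 := hN₀ n hn ((le_max_left _ _).trans hN)
  have ha0 := logNorming_nonneg p α n
  have hlp : logPlus (latticeSize n) = Real.log (latticeSize n) := max_eq_right hL1.le
  rw [hlp]
  set a := logNorming p α n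
  set N := latticeSize n
  set L := Real.log N with hL
  have hNpos : 0 < N := by linarith
  have hLpos : 0 < L := by linarith
  have haN : Real.sqrt N ≤ a := Real.sqrt_le_iff.2 ⟨ha0, by nlinarith⟩
  have ha : 0 < a := (Real.sqrt_pos.2 hNpos).trans_le haN
  have hl : 0 < Real.log L := Real.log_pos hL1
  have ht : 0 < M * Real.log L / (ε * a) := by positivity
  have hy' := hyx.trans_le (mul_le_mul_of_nonneg_left haN hδ0.le)
  refine (hX_nd.measureReal_abs_partialSum_le hX hξ hX_int hX_mean h hint hσ ht hy'
    hy' (a * ε) n).trans ?_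
  gcongr
  set t := M * Real.log L / (ε * a) with htdef
  set u := Real.sqrt L with hu
  have hu0 : 0 < u := Real.sqrt_pos.2 hLpos
  have huu : u * u = L := Real.mul_self_sqrt hLpos.le
  have hu1 : 1 ≤ u := Real.one_le_sqrt.2 hL1.le
  have e1 : t * (a * ε) = M * Real.log L := by rw [htdef]; field_simp
  have e2 : Real.exp (t * (δ * a)) = u := by
    have : t * (δ * a) = Real.log u := by
      rw [hu, Real.log_sqrt hLpos.le, htdef, hδ]; field_simp
    rw [this, Real.exp_log hu0]
  have e3 : Real.log L ^ 2 ≤ 16 * u := by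
    have h2 : Real.log L = 4 * Real.log (Real.sqrt u) := by
      rw [Real.log_sqrt hu0.le, hu, Real.log_sqrt hLpos.le]; ring
    have h3 := Real.log_le_sub_one_of_pos (Real.sqrt_pos.2 hu0)
    have h4 : 0 ≤ Real.log (Real.sqrt u) := Real.log_nonneg (Real.one_le_sqrt.2 hu1)
    have h5 := Real.mul_self_sqrt hu0.le
    rw [h2]
    nlinarith
  have e4 : t ^ 2 / 2 * u * (N * s₁) ≤ 8 * M ^ 2 * s₁ / ε ^ 2 := by
    rw [htdef, div_pow, div_div, div_mul_eq_mul_div, div_mul_eq_mul_div,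
      div_le_div_iff₀ (by positivity) (by positivity)]
    calc (M * Real.log L) ^ 2 * u * (N * s₁) * ε ^ 2 =
          M ^ 2 * s₁ * ε ^ 2 * N * u * Real.log L ^ 2 := by ring
      _ ≤ M ^ 2 * s₁ * ε ^ 2 * N * u * (16 * u) := by gcongr
      _ = 16 * M ^ 2 * s₁ * ε ^ 2 * (N * L) := by rw [← huu]; ring
      _ ≤ 16 * M ^ 2 * s₁ * ε ^ 2 * a ^ 2 := by gcongr
      _ = 8 * M ^ 2 * s₁ * ((ε * a) ^ 2 * 2) := by ring
  have e5 : u * (N * latticeSize n₀ * κ₁ * Q.real {ω | δ * a < |ξ ω|}) ≤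
      K₀ * σ ^ 2 / δ ^ 2 := by
    have h2 := measureReal_lt_abs_le hint (b := δ * a) (by positivity)
    rw [hσ] at h2
    calc u * (N * latticeSize n₀ * κ₁ * Q.real {ω | δ * a < |ξ ω|}) ≤
          u * (N * latticeSize n₀ * κ₁ * (σ ^ 2 / (δ * a) ^ 2)) := by gcongr
      _ = K₀ * σ ^ 2 * (u * N) / (δ ^ 2 * a ^ 2) := by rw [hK₀]; ring
      _ ≤ K₀ * σ ^ 2 * a ^ 2 / (δ ^ 2 * a ^ 2) := by
          have : u * N ≤ a ^ 2 := by nlinarith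
          gcongr
      _ = _ := by field_simp
  rw [Real.rpow_def_of_pos hLpos, ← Real.exp_add]
  refine Real.exp_le_exp.2 ?_
  rw [e1, e2]
  linarith

/-- A series over the lattice is summable if its terms obey the basic estimate for all but finitely
many lattice points. -/
theorem summable_of_bound {p : ℕ} (hp : 1 ≤ p) (hpd : p ≤ d) {α : Fin d → ℝ}
    (hα : ∀ i : Fin d, p ≤ i.val → 1 / 2 < α i) {r : ℝ} (hr : 2 ≤ r) (hξ : Measurable ξ)
    (hmom : LogMomentFinite ξ Q r p) {f g : (Fin d → ℕ+) → ℝ} (hf : ∀ n, 0 ≤ f n) {K δ C N₁ : ℝ}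
    (hδ : 0 < δ) (hg : Summable fun n => latticeSize n ^ (r / 2 - 2) * g n)
    (h : ∀ n : Fin d → ℕ+, 1 < headProd p n → N₁ ≤ latticeSize n →
      f n ≤ 2 * (latticeSize n * K * Q.real {ω | δ * logNorming p α n < |ξ ω|} + C * g n)) :
    Summable fun n : {n : Fin d → ℕ+ // 1 < headProd p n} =>
      latticeSize n.1 ^ (r / 2 - 2) * f n.1 := by
  have h1 := (hmom.summable_tail hp hpd hα hr hξ hδ).mul_left (2 * K)
  have h2 := (hg.comp_injective
    (Subtype.val_injective (p := fun n : Fin d → ℕ+ => 1 < headProd p n))).mul_left (2 * C)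
  refine Summable.of_norm_bounded_eventually (h1.add h2) ?_
  have hfin : {n : {n : Fin d → ℕ+ // 1 < headProd p n} | latticeSize n.1 < N₁}.Finite :=
    (finite_latticeSize_lt N₁).preimage Subtype.val_injective.injOn
  filter_upwards [hfin.compl_mem_cofinite] with n hn
  have hn' : N₁ ≤ latticeSize n.1 := not_lt.1 hn
  have hpos := latticeSize_pos n.1
  rw [Real.norm_of_nonneg (mul_nonneg (by positivity) (hf _))]
  refine (mul_le_mul_of_nonneg_left (h n.1 n.2 hn') (by positivity)).trans (le_of_eq ?_)
  have e : latticeSize n.1 ^ (r / 2 - 1) = latticeSize n.1 ^ (r / 2 - 2) * latticeSize n.1 := by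
    rw [← Real.rpow_add_one hpos.ne']
    congr 1; ring
  simp only [Function.comp_apply]
  rw [e]
  ring

/-- The direct half of the theorem. -/
theorem NegativelyDependent.summable_measureReal_abs_partialSum (hd : 0 < d)
    (hX_nd : NegativelyDependent X P)
    (hX : ∀ k, Measurable (X k)) (hξ : Measurable ξ) (hX_int : ∀ k, Integrable (X k) P)
    (hX_mean : ∀ k, ∫ ω, X k ω ∂P = 0) (h : WeaklyMeanBounded X P ξ Q κ₁ κ₂ n₀ x₀) {σ : ℝ}
    (hint : Integrable (fun ω => ξ ω ^ 2) Q) (hσ : ∫ ω, ξ ω ^ 2 ∂Q = σ ^ 2) {p : ℕ}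
    (hp : 1 ≤ p) (hpd : p ≤ d)
    {α : Fin d → ℝ} (hα : ∀ i : Fin d, p ≤ i.val → 1 / 2 < α i) {r : ℝ} (hr : 2 ≤ r)
    (hmom : LogMomentFinite ξ Q r p) {ε : ℝ}
    (hε : Real.sqrt (sigmaOneSq κ₁ n₀ x₀ σ) * Real.sqrt (r - 2) < ε) :
    Summable (fun n : {n : Fin d → ℕ+ // 1 < headProd p n} =>
      latticeSize n.1 ^ (r / 2 - 2) *
        P.real {ω | logNorming p α n.1 * ε ≤ |partialSum X n.1 ω|}) := by
  have hε0 : 0 < ε := lt_of_le_of_lt (by positivity) hε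
  have hf : ∀ n : Fin d → ℕ+, 0 ≤ P.real {ω | logNorming p α n * ε ≤ |partialSum X n ω|} :=
    fun _ => measureReal_nonneg
  rcases eq_or_lt_of_le hr with hr2 | hr2
  · obtain ⟨δ, C, N₁, hδ, hb⟩ := hX_nd.exists_bound_of_integrable_sq hd hX hξ hX_int hX_mean h hint
      hσ hα hε0
    have hg : Summable fun n : Fin d → ℕ+ => latticeSize n ^ (r / 2 - 2) *
        logPlus (latticeSize n) ^ (-(2 * d) : ℝ) := by
      rw [← hr2, show (2 : ℝ) / 2 - 2 = -1 by norm_num]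
      simp_rw [Real.rpow_neg_one]
      exact summable_latticeSize_logPlus d
    refine summable_of_bound (f := fun n => P.real {ω | logNorming p α n * ε ≤ |partialSum X n ω|})
      (K := latticeSize n₀ * κ₁) (C := C) (N₁ := N₁) hp hpd hα hr hξ hmom hf hδ hg
      fun n hn hN => ?_
    rw [← mul_assoc (latticeSize n)]
    exact hb n hn hN
  · have hκ := h.pos_left
    have hn₀ := latticeSize_pos n₀
    have hs0 : 0 ≤ sigmaOneSq κ₁ n₀ x₀ σ := by unfold sigmaOneSq; positivity
    -- The strict inequality for `ε` leaves room for some `τ` strictly above `r - 2`.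
    obtain ⟨τ, hτ, hτσ⟩ : ∃ τ : ℝ, r - 2 < τ ∧ τ * sigmaOneSq κ₁ n₀ x₀ σ ≤ ε ^ 2 := by
      have h1 : (r - 2) * sigmaOneSq κ₁ n₀ x₀ σ < ε ^ 2 := by
        have := pow_lt_pow_left₀ hε (by positivity) two_ne_zero
        rwa [mul_pow, Real.sq_sqrt hs0, Real.sq_sqrt (by linarith), mul_comm] at this
      have h2 : ∀ᶠ τ in 𝓝[>] (r - 2), τ * sigmaOneSq κ₁ n₀ x₀ σ < ε ^ 2 :=
        nhdsWithin_le_nhds ((continuous_id.mul continuous_const).continuousAt.eventually_lt_const h1)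
      obtain ⟨τ, h3, h4⟩ := (h2.and self_mem_nhdsWithin).exists
      exact ⟨τ, h4, h3.le⟩
    obtain ⟨δ, C, θ, N₁, hδ, hθ, hb⟩ := hX_nd.exists_bound_of_two_lt hX hξ hX_int hX_mean h hint
      hσ hα hr2 hmom hε0 hτ hτσ
    have hg : Summable fun n : Fin d → ℕ+ => latticeSize n ^ (r / 2 - 2) *
        latticeSize n ^ (-θ) := by
      simp_rw [← Real.rpow_add (latticeSize_pos _)]
      exact summable_latticeSize_rpow (by linarith)
    refine summable_of_bound (f := fun n => P.real {ω | logNorming p α n * ε ≤ |partialSum X n ω|})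
      (K := latticeSize n₀ * κ₁) (C := C) (N₁ := N₁) hp hpd hα hr hξ hmom hf hδ hg
      fun n hn hN => ?_
    rw [← mul_assoc (latticeSize n)]
    exact hb n hn hN

end DirectHalf

/-! ### Lower bound for the count on the head lattice, and recovery of the moment -/

section LowerCount

/-- With `M = ⌊w / 2⌋`, the block from `M` to `2 * M` lies in the range and has `M + 1 ≥ w / 4`
terms, each at least `(w / 4) ^ (s - 1)`. -/
theorem le_tsum_pnat_rpow {s : ℝ} (hs : 1 ≤ s) {w : ℝ} (hw : 4 ≤ w) :
    ENNReal.ofReal ((w / 4) ^ s) ≤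
      ∑' a : ℕ+, (if 1 < (a : ℝ) ∧ (a : ℝ) ≤ w then ENNReal.ofReal ((a : ℝ) ^ (s - 1)) else 0) := by
  have hM2 : 2 ≤ ⌊w / 2⌋₊ := Nat.le_floor (by push_cast; linarith)
  obtain ⟨M, hM⟩ : ∃ M : ℕ+, (M : ℕ) = ⌊w / 2⌋₊ :=
    ⟨Nat.toPNat ⌊w / 2⌋₊ (by omega), rfl⟩
  have hMw : (M : ℝ) ≤ w / 2 := by rw [hM]; exact Nat.floor_le (by linarith)
  have hMw' : w / 2 < M + 1 := by rw [hM]; exact Nat.lt_floor_add_one _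
  have hM2' : (2 : ℝ) ≤ M := by rw [hM]; exact_mod_cast hM2
  refine le_trans ?_ (ENNReal.sum_le_tsum (Finset.Icc M (2 * M)))
  calc ENNReal.ofReal ((w / 4) ^ s) ≤
        ENNReal.ofReal (((M : ℝ) + 1) * (w / 4) ^ (s - 1)) := by
        refine ENNReal.ofReal_le_ofReal ?_
        calc (w / 4) ^ s = w / 4 * (w / 4) ^ (s - 1) := by
              rw [← Real.rpow_one_add' (by linarith) (by linarith)]
              congr 1; ring
          _ ≤ _ := by
              gcongr
              linarith
    _ = ∑ a ∈ Finset.Icc M (2 * M), ENNReal.ofReal ((w / 4) ^ (s - 1)) := by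
        rw [Finset.sum_const, PNat.card_Icc, nsmul_eq_mul, ENNReal.ofReal_mul (by positivity)]
        congr 1
        rw [PNat.mul_coe, show ((2 : ℕ+) : ℕ) = 2 from rfl,
          show 2 * (M : ℕ) + 1 - M = M + 1 by omega]
        rw [← ENNReal.ofReal_natCast]
        push_cast
        rfl
    _ ≤ _ := by
        refine Finset.sum_le_sum fun a ha => ?_
        rw [Finset.mem_Icc] at ha
        have h1 : (M : ℝ) ≤ a := by exact_mod_cast ha.1
        have h2 : (a : ℝ) ≤ 2 * M := by exact_mod_cast ha.2
        rw [if_pos ⟨by linarith, by linarith⟩]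
        exact ENNReal.ofReal_le_ofReal (Real.rpow_le_rpow (by linarith) (by linarith)
          (by linarith))

theorem latticeSize_cons {k : ℕ} (a : ℕ+) (v : Fin k → ℕ+) :
    latticeSize (Fin.cons a v : Fin (k + 1) → ℕ+) = a * latticeSize v := by
  rw [latticeSize, Fin.prod_univ_succ]
  simp only [Fin.cons_zero, Fin.cons_succ]
  rfl

theorem log_le_sum_pnat_inv {R : ℝ} (hR : 1 ≤ R) {N : ℕ+} (hN : (N : ℕ) = ⌊R⌋₊) :
    Real.log R ≤ ∑ j ∈ Finset.Iic N, ((j : ℕ) : ℝ)⁻¹ := by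
  have e : ∑ j ∈ Finset.Iic N, ((j : ℕ) : ℝ)⁻¹ = ∑ a ∈ Finset.Icc 1 ⌊R⌋₊, (a : ℝ)⁻¹ := by
    rw [← hN]
    refine Finset.sum_bij (fun a _ => (a : ℕ)) ?_ ?_ ?_ ?_
    · intro a ha
      rw [Finset.mem_Iic] at ha
      rw [Finset.mem_Icc]
      exact ⟨a.pos, ha⟩
    · intro a _ b _ hab
      exact PNat.coe_injective hab
    · intro b hb
      rw [Finset.mem_Icc] at hb
      exact ⟨Nat.toPNat b hb.1, Finset.mem_Iic.2 hb.2, rfl⟩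
    · intro a _
      rfl
  have h1 := log_add_one_le_harmonic ⌊R⌋₊
  rw [harmonic_eq_sum_Icc] at h1
  push_cast at h1
  rw [e]
  refine le_trans (Real.log_le_log (by linarith) ?_) h1
  exact (Nat.lt_floor_add_one R).le

/-- Restrict the last `k` coordinates `v` to at most `R = z ^ (1 / (k + 1))`. The first coordinate
then still ranges up to `z / latticeSize v ≥ R ≥ 4`; summing over it leaves the weight `1 /
latticeSize v`, and the `k` harmonic sums give the logarithms. -/
theorem le_count {k : ℕ} {s : ℝ} (hs : 1 ≤ s) {z : ℝ} (hz : 4 ^ (k + 1) ≤ z) :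
    ENNReal.ofReal ((z / 4) ^ s * (Real.log z / (k + 1)) ^ k) ≤
      ∑' m : Fin (k + 1) → ℕ+, (if 1 < latticeSize m ∧ latticeSize m ≤ z then
        ENNReal.ofReal (latticeSize m ^ (s - 1)) else 0) := by
  have hz0 : 0 < z := lt_of_lt_of_le (by positivity) hz
  have hk : (0 : ℝ) < (k : ℝ) + 1 := by positivity
  set R := z ^ (1 / ((k : ℝ) + 1)) with hR
  have hRk : R ^ (k + 1) = z := by
    rw [hR, ← Real.rpow_natCast, ← Real.rpow_mul hz0.le]
    push_cast
    rw [one_div_mul_cancel hk.ne', Real.rpow_one]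
  have hR0 : 0 < R := by positivity
  have hR4 : 4 ≤ R := by
    rw [← hRk] at hz
    exact le_of_pow_le_pow_left₀ (by omega) hR0.le hz
  obtain ⟨N, hN⟩ : ∃ N : ℕ+, (N : ℕ) = ⌊R⌋₊ :=
    ⟨Nat.toPNat _ (Nat.floor_pos.2 (by linarith)), rfl⟩
  have hlogR : Real.log R = Real.log z / (k + 1) := by
    rw [hR, Real.log_rpow hz0]; ring
  rw [tsum_pi_succ]
  refine le_trans ?_ (ENNReal.sum_le_tsum (Fintype.piFinset fun _ : Fin k => Finset.Iic N))
  calc ENNReal.ofReal ((z / 4) ^ s * (Real.log z / (k + 1)) ^ k) ≤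
        ENNReal.ofReal ((z / 4) ^ s * (∑ j ∈ Finset.Iic N, ((j : ℕ) : ℝ)⁻¹) ^ k) := by
        refine ENNReal.ofReal_le_ofReal ?_
        rw [← hlogR]
        have := Real.log_nonneg (show 1 ≤ R by linarith)
        gcongr
        exact log_le_sum_pnat_inv (by linarith) hN
    _ = ∑ v ∈ Fintype.piFinset fun _ : Fin k => Finset.Iic N,
          ENNReal.ofReal ((z / 4) ^ s * (latticeSize v)⁻¹) := by
        rw [← ENNReal.ofReal_sum_of_nonneg fun v _ =>
          mul_nonneg (by positivity) (inv_nonneg.2 (latticeSize_pos v).le), ← Finset.mul_sum]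
        congr 2
        have := Finset.prod_univ_sum (fun _ : Fin k => Finset.Iic N)
          (fun _ j => ((j : ℕ) : ℝ)⁻¹)
        rw [Finset.prod_const, Finset.card_univ, Fintype.card_fin] at this
        rw [this]
        refine Finset.sum_congr rfl fun v _ => ?_
        rw [latticeSize, Finset.prod_inv_distrib]
    _ ≤ _ := by
        refine Finset.sum_le_sum fun v hv => ?_
        have hm := latticeSize_pos v
        have hm1 := one_le_latticeSize v
        have hmR : latticeSize v ≤ R ^ k := by
          have hcard : R ^ k = ∏ _i : Fin k, R := by simp
          rw [latticeSize, hcard]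
          refine Finset.prod_le_prod (fun _ _ => by positivity) fun i _ => ?_
          have h1 := Finset.mem_Iic.1 (Fintype.mem_piFinset.1 hv i)
          have h2 : ((v i : ℕ) : ℝ) ≤ (N : ℕ) := by exact_mod_cast h1
          refine h2.trans ?_
          rw [hN]
          exact Nat.floor_le hR0.le
        have hw : 4 ≤ z / latticeSize v := by
          rw [le_div_iff₀ hm, ← hRk, pow_succ']
          gcongr
        calc ENNReal.ofReal ((z / 4) ^ s * (latticeSize v)⁻¹) =
              ENNReal.ofReal (latticeSize v ^ (s - 1)) *
                ENNReal.ofReal ((z / latticeSize v / 4) ^ s) := by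
              rw [← ENNReal.ofReal_mul (by positivity), div_right_comm,
                Real.div_rpow (by positivity) hm.le, Real.rpow_sub_one hm.ne']
              congr 1
              have : 0 < latticeSize v ^ s := by positivity
              field_simp
          _ ≤ ENNReal.ofReal (latticeSize v ^ (s - 1)) * ∑' a : ℕ+,
                (if 1 < (a : ℝ) ∧ (a : ℝ) ≤ z / latticeSize v then
                  ENNReal.ofReal ((a : ℝ) ^ (s - 1)) else 0) := by
              gcongr
              exact le_tsum_pnat_rpow hs hw
          _ ≤ _ := by
              rw [← ENNReal.tsum_mul_left]
              refine ENNReal.tsum_le_tsum fun a => ?_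
              rw [latticeSize_cons]
              by_cases h : 1 < (a : ℝ) ∧ (a : ℝ) ≤ z / latticeSize v
              · rw [if_pos h, if_pos ⟨by nlinarith, (le_div_iff₀ hm).1 h.2⟩,
                  ← ENNReal.ofReal_mul (by positivity), mul_comm (a : ℝ),
                  Real.mul_rpow hm.le (by positivity)]
              · rw [if_neg h, mul_zero]
                exact zero_le

theorem logPlus_le_of_le {x y : ℝ} (hx : 0 ≤ x) (hxy : x ≤ y) :
    logPlus x ≤ logPlus y := by
  rcases le_total 1 x with h | h
  · exact logPlus_le_logPlus h hxy
  · refine max_le (one_le_logPlus y) ?_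
    exact (Real.log_nonpos hx h).trans (logPlus_pos y).le

/-- The number of head points below a level, with weights, dominates the moment function. -/
theorem exists_le_count (k : ℕ) {s : ℝ} (hs : 1 ≤ s) :
    ∃ c y₁ : ℝ, 0 < c ∧ 1 ≤ y₁ ∧ ∀ y : ℝ, y₁ ≤ y →
      ENNReal.ofReal (c * (y ^ (2 * s) * logPlus y ^ ((k : ℝ) - s))) ≤
      ∑' m : Fin (k + 1) → ℕ+, (if 1 < latticeSize m ∧
        Real.sqrt (latticeSize m * Real.log (latticeSize m)) < y then
        ENNReal.ofReal (latticeSize m ^ (s - 1)) else 0) := by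
  have hev : ∀ᶠ y : ℝ in atTop, 1 ≤ y ∧ 1 ≤ Real.log y ∧ 4 ^ (k + 1) ≤ y ∧
      4 * Real.log y ≤ y := by
    have h1 := (Real.isLittleO_log_id_atTop).bound (show (0 : ℝ) < 1 / 4 by norm_num)
    filter_upwards [eventually_ge_atTop 1, Real.tendsto_log_atTop.eventually_ge_atTop 1,
      eventually_ge_atTop (4 ^ (k + 1)), h1] with y a b c e
    refine ⟨a, b, c, ?_⟩
    rw [Real.norm_of_nonneg (by linarith), id, Real.norm_of_nonneg (by linarith)] at e
    linarith
  obtain ⟨y₁, hy₁⟩ := eventually_atTop.1 hev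
  refine ⟨(1 / 16) ^ s * (1 / ((k : ℝ) + 1)) ^ k, max 1 y₁, by positivity, le_max_left _ _,
    fun y hy => ?_⟩
  obtain ⟨h1, hl1, h4, h5⟩ := hy₁ y ((le_max_right _ _).trans hy)
  have hlp : logPlus y = Real.log y := max_eq_right hl1
  set l := Real.log y with hl
  have hl0 : 0 < l := by linarith
  have hy0 : 0 < y := by linarith
  rw [hlp]
  -- Approximate inverse of `√(H log H)`: from `H ≤ z` follows `log H ≤ 2 l`, hence `H log H ≤ y ^ 2
  -- / 2`.
  set z := y ^ 2 / (4 * l) with hz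
  have hz0 : 0 < z := by positivity
  have hzy : y ≤ z := by
    rw [hz, le_div_iff₀ (by positivity)]
    nlinarith
  have hlz : l ≤ Real.log z := Real.log_le_log hy0 hzy
  calc ENNReal.ofReal ((1 / 16) ^ s * (1 / ((k : ℝ) + 1)) ^ k * (y ^ (2 * s) * l ^ ((k : ℝ) - s)))
      = ENNReal.ofReal ((z / 4) ^ s * (l / (k + 1)) ^ k) := by
        congr 1
        have e1 : y ^ (2 * s) = (y ^ 2) ^ s := by
          rw [Real.rpow_mul hy0.le]; norm_num
        have e2 : z / 4 = 1 / 16 * y ^ 2 / l := by rw [hz]; field_simp; norm_num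
        rw [e1, e2, Real.div_rpow (by positivity) hl0.le, Real.mul_rpow (by norm_num)
          (by positivity), Real.rpow_sub hl0, Real.rpow_natCast, div_pow, div_pow, one_pow]
        have : 0 < l ^ s := by positivity
        field_simp
    _ ≤ ENNReal.ofReal ((z / 4) ^ s * (Real.log z / (k + 1)) ^ k) := by
        gcongr
    _ ≤ _ := le_count hs (h4.trans hzy)
    _ ≤ _ := by
        refine ENNReal.tsum_le_tsum fun m => ?_
        by_cases h : 1 < latticeSize m ∧ latticeSize m ≤ z
        · rw [if_pos h, if_pos]
          refine ⟨h.1, (Real.sqrt_lt' hy0).2 ?_⟩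
          have hm := latticeSize_pos m
          have e1 : Real.log (latticeSize m) ≤ 2 * l := by
            have e2 : latticeSize m ≤ y ^ 2 := by
              refine h.2.trans ?_
              rw [hz]
              exact div_le_self (by positivity) (by linarith)
            have := Real.log_le_log hm e2
            rwa [Real.log_pow, Nat.cast_ofNat] at this
          calc latticeSize m * Real.log (latticeSize m) ≤ z * (2 * l) := by
                have := Real.log_nonneg h.1.le
                exact mul_le_mul h.2 e1 this hz0.le
            _ = y ^ 2 / 2 := by rw [hz]; field_simp; norm_num
            _ < y ^ 2 := by nlinarith
        · rw [if_neg h]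
          exact zero_le

variable {Ω : Type*} [MeasurableSpace Ω]

/-- Tonelli turns the series into the expected count at level `|ξ|`, which dominates the moment
function wherever `|ξ| ≥ y₁`; below `y₁` that function is bounded. -/
theorem logMomentFinite_of_summable {k : ℕ} {r : ℝ} (hr : 2 ≤ r) {ξ : Ω → ℝ} {Q : Measure Ω}
    [IsProbabilityMeasure Q] (hξ : Measurable ξ)
    (h : Summable fun m : {m : Fin (k + 1) → ℕ+ // 1 < latticeSize m} =>
      latticeSize m.1 ^ (r / 2 - 1) *
        Q.real {ω | Real.sqrt (latticeSize m.1 * Real.log (latticeSize m.1)) < |ξ ω|}) :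
    LogMomentFinite ξ Q r (k + 1) := by
  obtain ⟨c, y₁, hc, hy₁, hcy⟩ := exists_le_count k (s := r / 2) (by linarith)
  set β := ((k + 1 : ℕ) : ℝ) - 1 - r / 2 with hβ
  set F : Ω → ℝ := fun ω => |ξ ω| ^ r * logPlus |ξ ω| ^ β with hF
  have hF0 : ∀ ω, 0 ≤ F ω := fun ω =>
    mul_nonneg (by positivity) (Real.rpow_nonneg (logPlus_pos _).le _)
  have hFm : Measurable F :=
    (hξ.abs.pow_const r).mul ((measurable_logPlus.comp hξ.abs).pow_const _)
  set b : (Fin (k + 1) → ℕ+) → ℝ := fun m =>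
    Real.sqrt (latticeSize m * Real.log (latticeSize m))
  have hms : ∀ m : Fin (k + 1) → ℕ+, MeasurableSet {ω | b m < |ξ ω|} :=
    fun m => measurableSet_lt measurable_const hξ.abs
  have hGm : ∀ m : Fin (k + 1) → ℕ+, Measurable fun ω => (if 1 < latticeSize m ∧ b m < |ξ ω| then
      ENNReal.ofReal (latticeSize m ^ (r / 2 - 1)) else 0) := by
    intro m
    by_cases hm : 1 < latticeSize m
    · simp only [hm, true_and]
      exact Measurable.ite (hms m) measurable_const measurable_const
    · simp [hm]
  have hG : ∫⁻ ω, ∑' m : Fin (k + 1) → ℕ+, (if 1 < latticeSize m ∧ b m < |ξ ω| then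
      ENNReal.ofReal (latticeSize m ^ (r / 2 - 1)) else 0) ∂Q < ∞ := by
    rw [lintegral_tsum fun m => (hGm m).aemeasurable]
    have e : ∀ m : Fin (k + 1) → ℕ+, ∫⁻ ω, (if 1 < latticeSize m ∧ b m < |ξ ω| then
        ENNReal.ofReal (latticeSize m ^ (r / 2 - 1)) else 0) ∂Q =
        {m : Fin (k + 1) → ℕ+ | 1 < latticeSize m}.indicator (fun m =>
          ENNReal.ofReal (latticeSize m ^ (r / 2 - 1) * Q.real {ω | b m < |ξ ω|})) m := by
      intro m
      by_cases hm : 1 < latticeSize m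
      · rw [Set.indicator_of_mem (by exact hm),
          ENNReal.ofReal_mul (Real.rpow_nonneg (latticeSize_pos m).le _), ofReal_measureReal,
          ← lintegral_indicator_const (hms m)]
        simp only [hm, true_and]
        rfl
      · rw [Set.indicator_of_notMem (by exact hm)]
        simp [hm]
    rw [tsum_congr e, ← _root_.tsum_subtype]
    exact h.tsum_ofReal_lt_top
  have hbd : ∀ ω, ENNReal.ofReal (F ω) ≤ ENNReal.ofReal (y₁ ^ r * logPlus y₁ ^ |β|) +
      ENNReal.ofReal c⁻¹ * ∑' m : Fin (k + 1) → ℕ+, (if 1 < latticeSize m ∧ b m < |ξ ω| then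
        ENNReal.ofReal (latticeSize m ^ (r / 2 - 1)) else 0) := by
    intro ω
    rcases le_total y₁ |ξ ω| with hω | hω
    · refine le_add_left ?_
      have h1 := hcy _ hω
      rw [show 2 * (r / 2) = r by ring, show (k : ℝ) - r / 2 = β by rw [hβ]; push_cast; ring] at h1
      calc ENNReal.ofReal (F ω) = ENNReal.ofReal c⁻¹ * ENNReal.ofReal (c * F ω) := by
            rw [← ENNReal.ofReal_mul (by positivity), inv_mul_cancel_left₀ hc.ne']
        _ ≤ _ := by
            gcongr
    · refine le_add_right (ENNReal.ofReal_le_ofReal ?_)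
      have h1 := logPlus_le_of_le (abs_nonneg (ξ ω)) hω
      have h2 : logPlus |ξ ω| ^ β ≤ logPlus y₁ ^ |β| :=
        (Real.rpow_le_rpow_of_exponent_le (one_le_logPlus _) (le_abs_self β)).trans
          (Real.rpow_le_rpow (logPlus_pos _).le h1 (abs_nonneg β))
      exact mul_le_mul (Real.rpow_le_rpow (abs_nonneg _) hω (by linarith)) h2
        (Real.rpow_nonneg (logPlus_pos _).le _) (by positivity)
  refine ⟨hFm.aestronglyMeasurable, ?_⟩
  rw [hasFiniteIntegral_iff_ofReal (Eventually.of_forall hF0)]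
  refine (lintegral_mono hbd).trans_lt ?_
  rw [lintegral_add_left measurable_const, lintegral_const, measure_univ, mul_one,
    lintegral_const_mul' _ _ ENNReal.ofReal_ne_top]
  exact ENNReal.add_lt_top.2 ⟨ENNReal.ofReal_lt_top, ENNReal.mul_lt_top ENNReal.ofReal_lt_top hG⟩

end LowerCount

/-! ### The converse half -/

section Converse

/-- An antitone `u` with `∑ j^(s-2) min(1, j u(j)) < ∞` satisfies `u(j) = O(1/j)`. -/
theorem exists_mul_le_of_summable {s : ℝ} (hs : 1 ≤ s) {u : ℝ → ℝ} (hu0 : ∀ x, 0 ≤ u x)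
    (hu1 : ∀ x, u x ≤ 1) (hu : AntitoneOn u (Set.Ici 1))
    (h : Summable fun j : ℕ => ((j : ℝ) + 2) ^ (s - 2) * min 1 (((j : ℝ) + 2) * u (j + 2))) :
    ∃ K : ℝ, 1 ≤ K ∧ ∀ j : ℕ, 1 ≤ j → (j : ℝ) * u j ≤ K := by
  -- Since `s ≥ 1`, the weight is at least the reciprocal; so this antitone sequence is dominated by
  -- the given summable one.
  set g : ℕ → ℝ := fun j => min (((j : ℝ) + 2)⁻¹) (u (j + 2)) with hg
  have hg0 : ∀ j, 0 ≤ g j := fun j => le_min (by positivity) (hu0 _)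
  have hgs : Summable g := by
    refine Summable.of_nonneg_of_le hg0 (fun j => ?_) h
    have hj : (1 : ℝ) ≤ (j : ℝ) + 2 := by have : (0 : ℝ) ≤ j := by positivity
                                          linarith
    have hj0 : (0 : ℝ) < (j : ℝ) + 2 := by linarith
    have h1 : ((j : ℝ) + 2)⁻¹ ≤ ((j : ℝ) + 2) ^ (s - 2) := by
      rw [← Real.rpow_neg_one]
      exact Real.rpow_le_rpow_of_exponent_le hj (by linarith)
    have h2 : 0 ≤ min 1 (((j : ℝ) + 2) * u (j + 2)) :=
      le_min zero_le_one (mul_nonneg hj0.le (hu0 _))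
    refine le_trans (le_of_eq ?_) (mul_le_mul_of_nonneg_right h1 h2)
    rw [mul_min_of_nonneg _ _ (inv_nonneg.2 hj0.le), mul_one, inv_mul_cancel_left₀ hj0.ne']
  have hga : Antitone g := by
    intro i j hij
    have hij' : (i : ℝ) ≤ j := by exact_mod_cast hij
    have hi : (0 : ℝ) ≤ i := by positivity
    refine min_le_min (inv_anti₀ (by linarith) (by linarith)) (hu ?_ ?_ (by linarith)) <;>
      · rw [Set.mem_Ici]; linarith
  obtain ⟨t, ht⟩ := summable_iff_vanishing_norm.1 hgs (1 / 4) (by norm_num)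
  obtain ⟨N₀, hN₀⟩ : ∃ N₀ : ℕ, ∀ i ∈ t, i < N₀ :=
    ⟨t.sup id + 1, fun i hi => Nat.lt_succ_of_le (Finset.le_sup (f := id) hi)⟩
  -- If this failed, `g (2 * N + 2)` would equal `1 / (2 * (N + 2))` and bound from below the `N +
  -- 2` terms of a block, whose sum would be at least `1 / 2`; tail blocks sum to less than `1 / 4`.
  have hN : ∀ N : ℕ, N₀ ≤ N → (2 * ((N : ℝ) + 2)) * u (2 * ((N : ℝ) + 2)) ≤ 1 := by
    intro N hNN
    by_contra hcon
    push Not at hcon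
    have hN0 : (0 : ℝ) ≤ N := by positivity
    have h1 := ht (Finset.Ico N (2 * N + 2)) (by
      rw [Finset.disjoint_left]
      intro i hi hit
      have := hN₀ i hit
      have := (Finset.mem_Ico.1 hi).1
      omega)
    rw [Real.norm_of_nonneg (Finset.sum_nonneg fun i _ => hg0 i)] at h1
    have h2 := Finset.card_nsmul_le_sum (Finset.Ico N (2 * N + 2)) g (g (2 * N + 2))
      fun i hi => hga (Finset.mem_Ico.1 hi).2.le
    rw [Nat.card_Ico, nsmul_eq_mul, show 2 * N + 2 - N = N + 2 by omega] at h2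
    have h3 : g (2 * N + 2) = (2 * ((N : ℝ) + 2))⁻¹ := by
      have e : ((2 * N + 2 : ℕ) : ℝ) + 2 = 2 * ((N : ℝ) + 2) := by push_cast; ring
      simp only [hg]
      rw [e]
      refine min_eq_left ?_
      rw [inv_le_iff_one_le_mul₀' (by positivity)]
      exact hcon.le
    rw [h3] at h2
    push_cast at h2
    have h4 : ((N : ℝ) + 2) * (2 * ((N : ℝ) + 2))⁻¹ = 1 / 2 := by field_simp
    linarith
  refine ⟨2 * ((N₀ : ℝ) + 2) + 2, by have : (0 : ℝ) ≤ N₀ := by positivity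
                                     linarith, fun j hj => ?_⟩
  have hj1 : (1 : ℝ) ≤ j := by exact_mod_cast hj
  have hN0 : (0 : ℝ) ≤ N₀ := by positivity
  rcases le_total j (2 * (N₀ + 2)) with hc | hc
  · have hc' : (j : ℝ) ≤ 2 * ((N₀ : ℝ) + 2) := by exact_mod_cast hc
    nlinarith [hu1 j, hu0 j]
  · obtain ⟨M, hM, hMj, hjM⟩ : ∃ M : ℕ, N₀ ≤ M ∧ 2 * (M + 2) ≤ j ∧ j ≤ 2 * (M + 2) + 1 :=
      ⟨j / 2 - 2, by omega, by omega, by omega⟩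
    have h1 : (2 * ((M : ℝ) + 2)) ≤ j := by exact_mod_cast hMj
    have h2 : (j : ℝ) ≤ 2 * ((M : ℝ) + 2) + 1 := by exact_mod_cast hjM
    have hM0 : (0 : ℝ) ≤ M := by positivity
    have h3 : u j ≤ u (2 * ((M : ℝ) + 2)) :=
      hu (by rw [Set.mem_Ici]; linarith) (by rw [Set.mem_Ici]; linarith) h1
    have h4 := hN M hM
    nlinarith [hu0 (j : ℝ), hu1 (2 * ((M : ℝ) + 2))]

/-- Removal of the truncation at `1`. -/
theorem summable_of_summable_min {k : ℕ} {s : ℝ} (hs : 1 ≤ s) {u : ℝ → ℝ} (hu0 : ∀ x, 0 ≤ u x)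
    (hu1 : ∀ x, u x ≤ 1) (hu : AntitoneOn u (Set.Ici 1))
    (h : Summable fun m : {m : Fin (k + 1) → ℕ+ // 1 < latticeSize m} =>
      latticeSize m.1 ^ (s - 2) * min 1 (latticeSize m.1 * u (latticeSize m.1))) :
    Summable fun m : {m : Fin (k + 1) → ℕ+ // 1 < latticeSize m} =>
      latticeSize m.1 ^ (s - 1) * u (latticeSize m.1) := by
  -- Along the axis points `(j + 2, 1, …, 1)` the hypothesis becomes a one-dimensional series, which
  -- already forces `H * u H` to be bounded. Then `min 1` costs only a constant at every point.
  set e : ℕ → (Fin (k + 1) → ℕ+) := fun j => Fin.cons (Nat.succPNat (j + 1)) fun _ => 1 with he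
  have hej : ∀ j, latticeSize (e j) = (j : ℝ) + 2 := by
    intro j
    rw [he]
    simp only
    rw [latticeSize_cons, Nat.succPNat_coe]
    simp [latticeSize]
    norm_num [add_assoc]
  have he1 : ∀ j, 1 < latticeSize (e j) := by
    intro j
    rw [hej]
    have : (0 : ℝ) ≤ j := by positivity
    linarith
  have hinj : Function.Injective fun j : ℕ =>
      (⟨e j, he1 j⟩ : {m : Fin (k + 1) → ℕ+ // 1 < latticeSize m}) := by
    intro i j hij
    have h1 := congrArg (fun m => latticeSize m.1) hij
    simp only [hej] at h1
    exact_mod_cast add_right_cancel h1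
  have h1 := h.comp_injective hinj
  obtain ⟨K, hK1, hK⟩ := exists_mul_le_of_summable hs hu0 hu1 hu (h1.congr fun j => by
    simp only [Function.comp_apply, hej])
  refine Summable.of_nonneg_of_le (fun m => mul_nonneg
    (Real.rpow_nonneg (latticeSize_pos _).le _) (hu0 _)) (fun m => ?_) (h.mul_left K)
  have hm := latticeSize_pos m.1
  have h2 : latticeSize m.1 * u (latticeSize m.1) ≤ K := by
    have e1 : latticeSize m.1 = ((∏ i, (m.1 i : ℕ) : ℕ) : ℝ) := by simp [latticeSize]
    have := one_le_latticeSize m.1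
    rw [e1] at this ⊢
    exact hK _ (by exact_mod_cast this)
  have h3 : latticeSize m.1 * u (latticeSize m.1) ≤
      K * min 1 (latticeSize m.1 * u (latticeSize m.1)) := by
    have h0 : 0 ≤ latticeSize m.1 * u (latticeSize m.1) := mul_nonneg hm.le (hu0 _)
    rw [mul_min_of_nonneg _ _ (by linarith), mul_one]
    exact le_min h2 (le_mul_of_one_le_left h0 hK1)
  calc latticeSize m.1 ^ (s - 1) * u (latticeSize m.1) =
        latticeSize m.1 ^ (s - 2) * (latticeSize m.1 * u (latticeSize m.1)) := by
        rw [← mul_assoc, ← Real.rpow_add_one hm.ne']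
        congr 2; ring
    _ ≤ latticeSize m.1 ^ (s - 2) * (K * min 1 (latticeSize m.1 * u (latticeSize m.1))) := by
        gcongr
    _ = _ := by ring

/-- The lattice point with the head `n₀ * m` and the tail of `n₀`. -/
def headEmbed {d p : ℕ} (n₀ : Fin d → ℕ+) (m : Fin p → ℕ+) : Fin d → ℕ+ :=
  fun i => n₀ i * if h : i.val < p then m ⟨i.val, h⟩ else 1

/-! ### A copy of the head lattice above `n₀` -/

section HeadEmbed

variable {d p : ℕ} (n₀ : Fin d → ℕ+)

theorem le_headEmbed (m : Fin p → ℕ+) : n₀ ≤ headEmbed n₀ m :=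
  fun _ => le_mul_of_one_le_right' one_le

theorem headEmbed_injective (hpd : p ≤ d) :
    Function.Injective (headEmbed n₀ : (Fin p → ℕ+) → Fin d → ℕ+) := by
  intro m m' h
  funext j
  have h1 := congrFun h (Fin.castLE hpd j)
  simp only [headEmbed, Fin.val_castLE, j.isLt, dif_pos, Fin.eta] at h1
  exact mul_left_cancel h1

theorem headProd_headEmbed (hpd : p ≤ d) (m : Fin p → ℕ+) :
    headProd p (headEmbed n₀ m) = headProd p n₀ * latticeSize m := by
  have h1 : latticeSize m = ∏ i : Fin d with i.val < p,
      ((if h : i.val < p then m ⟨i.val, h⟩ else 1 : ℕ+) : ℝ) := by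
    rw [latticeSize]
    refine Finset.prod_bij (fun j _ => Fin.castLE hpd j) ?_ ?_ ?_ ?_
    · intro j _
      simp
    · intro i _ j _ hij
      exact Fin.castLE_injective hpd hij
    · intro i hi
      have hi' := (Finset.mem_filter.1 hi).2
      exact ⟨⟨i.val, hi'⟩, Finset.mem_univ _, rfl⟩
    · intro j _
      simp
  rw [h1, headProd, headProd, ← Finset.prod_mul_distrib]
  refine Finset.prod_congr rfl fun i _ => ?_
  rw [headEmbed, PNat.mul_coe, Nat.cast_mul]

theorem tailProd_headEmbed (m : Fin p → ℕ+) :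
    tailProd p (headEmbed n₀ m) = tailProd p n₀ := by
  refine Finset.prod_congr rfl fun i hi => ?_
  rw [headEmbed, dif_neg (not_lt.2 (Finset.mem_filter.1 hi).2), mul_one]

theorem tailPow_headEmbed (α : Fin d → ℝ) (m : Fin p → ℕ+) :
    tailPow p α (headEmbed n₀ m) = tailPow p α n₀ := by
  refine Finset.prod_congr rfl fun i hi => ?_
  rw [headEmbed, dif_neg (not_lt.2 (Finset.mem_filter.1 hi).2), mul_one]

theorem latticeSize_headEmbed (hpd : p ≤ d) (m : Fin p → ℕ+) :
    latticeSize (headEmbed n₀ m) = latticeSize n₀ * latticeSize m := by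
  rw [← headProd_mul_tailProd p, ← headProd_mul_tailProd p n₀, headProd_headEmbed n₀ hpd,
    tailProd_headEmbed]
  ring

/-- The tail factor is constant on the embedded lattice, and `log (h₀ * H) ≤ (2 * log h₀ + 1) * log
H` because `log H ≥ 1 / 2` for `H ≥ 2`. -/
theorem exists_logNorming_headEmbed_le (hpd : p ≤ d) (α : Fin d → ℝ) :
    ∃ C : ℝ, 0 < C ∧ ∀ m : Fin p → ℕ+, 1 < latticeSize m →
      logNorming p α (headEmbed n₀ m) ≤
        C * Real.sqrt (latticeSize m * Real.log (latticeSize m)) := by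
  have hh := one_le_headProd p n₀
  have hT : 0 < tailPow p α n₀ := Finset.prod_pos fun i _ => by
    have : (0 : ℝ) < n₀ i := by exact_mod_cast (n₀ i).pos
    positivity
  have hlh := Real.log_nonneg hh
  set h₀ := headProd p n₀
  set T := tailPow p α n₀
  refine ⟨Real.sqrt (h₀ * (2 * Real.log h₀ + 1) * T), by positivity, fun m hm => ?_⟩
  have hm2 : 2 ≤ latticeSize m := by
    have e1 : latticeSize m = ((∏ i, (m i : ℕ) : ℕ) : ℝ) := by simp [latticeSize]
    rw [e1] at hm ⊢
    exact_mod_cast hm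
  have hl := Real.log_two_gt_d9
  have hlm := Real.log_le_log (by norm_num) hm2
  rw [← Real.sqrt_mul (by positivity)]
  refine Real.le_sqrt_of_sq_le ?_
  rw [logNorming_sq, headProd_headEmbed n₀ hpd, tailPow_headEmbed,
    Real.log_mul (by positivity) (by positivity)]
  set H := latticeSize m
  change h₀ * H * (Real.log h₀ + Real.log H) * T ≤ _
  have h1 : Real.log h₀ + Real.log H ≤ (2 * Real.log h₀ + 1) * Real.log H := by nlinarith
  calc h₀ * H * (Real.log h₀ + Real.log H) * T ≤
        h₀ * H * ((2 * Real.log h₀ + 1) * Real.log H) * T := by gcongr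
    _ = _ := by ring

end HeadEmbed

variable {d : ℕ} {Ω Ω' : Type*} [MeasurableSpace Ω] [MeasurableSpace Ω']
  {X : (Fin d → ℕ+) → Ω → ℝ} {P : Measure Ω} [IsProbabilityMeasure P] {ξ : Ω' → ℝ}
  {Q : Measure Ω'} {κ₁ κ₂ : ℝ} {n₀ : Fin d → ℕ+} {x₀ : ℝ}

/-- If all partial sums below `n` were smaller than `x` in absolute value, every `|X k|` would be at
most `2 ^ d * x ≤ y`. So some `|X k| > y` forces the maximum to reach `x`. -/
theorem NegativelyDependent.min_one_le_measureReal_max (hX_nd : NegativelyDependent X P)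
    (hX : ∀ k, Measurable (X k)) (h : WeaklyMeanBounded X P ξ Q κ₁ κ₂ n₀ x₀)
    {n : Fin d → ℕ+} (hn : n₀ ≤ n) {x y : ℝ} (hy : x₀ < y) (hxy : 2 ^ d * x ≤ y) :
    min 1 (latticeSize n * (κ₂ * Q.real {ω | y < |ξ ω|})) ≤
      4 * P.real {ω | x ≤ maxAbsPartialSum X n ω} := by
  have h1 : latticeSize n * (κ₂ * Q.real {ω | y < |ξ ω|}) ≤
      ∑ k ∈ Finset.Iic n, P.real {ω | y < |X k ω|} := by
    have := h.lower y hy n hn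
    rwa [one_div, le_inv_mul_iff₀ (latticeSize_pos n)] at this
  refine (min_le_min le_rfl h1).trans ((hX_nd.min_one_sum_le hX y (Finset.Iic n)).trans ?_)
  refine mul_le_mul_of_nonneg_left (measureReal_mono ?_) (by norm_num)
  rintro ω ⟨k, hk, hkω⟩
  by_contra hcon
  rw [Set.mem_ofPred_eq, not_le] at hcon
  have h2 := abs_le_of_abs_partialSum_le X ω n (M := x) (fun j hj =>
    (Finset.le_sup' (fun k => |partialSum X k ω|) (Finset.mem_Iic.2 hj)).trans hcon.le)
    (Finset.mem_Iic.1 hk)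
  linarith

/-- The converse half of the theorem. -/
theorem NegativelyDependent.logMomentFinite [IsProbabilityMeasure Q] (hX_nd : NegativelyDependent X P)
    (hX : ∀ k, Measurable (X k)) (hξ : Measurable ξ)
    (h : WeaklyMeanBounded X P ξ Q κ₁ κ₂ n₀ x₀) {p : ℕ} (hp : 1 ≤ p) (hpd : p ≤ d)
    {α : Fin d → ℝ} {r : ℝ} (hr : 2 ≤ r) {ε : ℝ} (hε : 0 < ε)
    (hsum : Summable (fun n : {n : Fin d → ℕ+ // 1 < headProd p n} =>
      latticeSize n.1 ^ (r / 2 - 2) *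
        P.real {ω | logNorming p α n.1 * ε ≤ maxAbsPartialSum X n.1 ω})) :
    LogMomentFinite ξ Q r p := by
  obtain ⟨k, rfl⟩ : ∃ k, p = k + 1 := ⟨p - 1, by omega⟩
  obtain ⟨C, hC, hCm⟩ := exists_logNorming_headEmbed_le n₀ hpd α
  have hx₀ := h.threshold_nonneg
  have hκ := h.pos_right
  have hn₀ := latticeSize_pos n₀
  -- The first summand absorbs `2 ^ d`, `ε` and the comparison of normings; `x₀ + 1` puts the level
  -- above `x₀`, as `√(H log H) ≥ 1` for `H ≥ 2`.
  set D := 2 ^ d * C * ε + x₀ + 1 with hD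
  have hD0 : 0 < D := by positivity
  set u : ℝ → ℝ := fun H => Q.real {ω | Real.sqrt (H * Real.log H) < |D⁻¹ * ξ ω|} with hu
  have huD : ∀ H, u H = Q.real {ω | D * Real.sqrt (H * Real.log H) < |ξ ω|} := by
    intro H
    rw [hu]
    simp only
    congr 1
    ext ω
    simp only [Set.mem_ofPred_eq]
    rw [abs_mul, abs_of_pos (inv_pos.2 hD0), lt_inv_mul_iff₀ hD0]
  have hanti : AntitoneOn u (Set.Ici 1) := by
    intro x hx y hy hxy
    rw [Set.mem_Ici] at hx hy
    refine measureReal_mono fun ω hω => lt_of_le_of_lt (b := Real.sqrt (y * Real.log y)) ?_ hω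
    exact Real.sqrt_le_sqrt (mul_le_mul hxy (Real.log_le_log (by linarith) hxy)
      (Real.log_nonneg hx) (by linarith))
  have hhead : ∀ m : {m : Fin (k + 1) → ℕ+ // 1 < latticeSize m},
      1 < headProd (k + 1) (headEmbed n₀ m.1) := by
    intro m
    rw [headProd_headEmbed n₀ hpd]
    have := one_le_headProd (k + 1) n₀
    have := m.2
    nlinarith
  have hinj : Function.Injective fun m : {m : Fin (k + 1) → ℕ+ // 1 < latticeSize m} =>
      (⟨headEmbed n₀ m.1, hhead m⟩ : {n : Fin d → ℕ+ // 1 < headProd (k + 1) n}) := by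
    intro m m' hm
    exact Subtype.ext (headEmbed_injective n₀ hpd (congrArg Subtype.val hm))
  have h1 := hsum.comp_injective hinj
  set c := latticeSize n₀ * κ₂ with hc
  have hc0 : 0 < c := by positivity
  have h2 : Summable fun m : {m : Fin (k + 1) → ℕ+ // 1 < latticeSize m} =>
      latticeSize m.1 ^ (r / 2 - 2) * min 1 (latticeSize m.1 * u (latticeSize m.1)) := by
    refine Summable.of_nonneg_of_le (fun m => ?_) (fun m => ?_)
      (h1.mul_left (max 1 c⁻¹ * 4 * (latticeSize n₀ ^ (r / 2 - 2))⁻¹))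
    · exact mul_nonneg (Real.rpow_nonneg (latticeSize_pos _).le _)
        (le_min zero_le_one (mul_nonneg (latticeSize_pos _).le measureReal_nonneg))
    · have hH := m.2
      have hH0 := latticeSize_pos m.1
      have hb : 1 ≤ Real.sqrt (latticeSize m.1 * Real.log (latticeSize m.1)) := by
        have hm2 : 2 ≤ latticeSize m.1 := by
          have e1 : latticeSize m.1 = ((∏ i, (m.1 i : ℕ) : ℕ) : ℝ) := by simp [latticeSize]
          rw [e1] at hH ⊢
          exact_mod_cast hH
        have hl := Real.log_two_gt_d9
        have hlm := Real.log_le_log (by norm_num) hm2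
        refine Real.one_le_sqrt.2 ?_
        nlinarith
      have h3 := hX_nd.min_one_le_measureReal_max hX h (le_headEmbed n₀ m.1)
        (x := logNorming (k + 1) α (headEmbed n₀ m.1) * ε)
        (y := D * Real.sqrt (latticeSize m.1 * Real.log (latticeSize m.1)))
        (by nlinarith [show 0 < 2 ^ d * C * ε by positivity])
        (by
          calc 2 ^ d * (logNorming (k + 1) α (headEmbed n₀ m.1) * ε) ≤
                2 ^ d * (C * Real.sqrt (latticeSize m.1 * Real.log (latticeSize m.1)) * ε) := by
                have := hCm m.1 hH
                gcongr
            _ = 2 ^ d * C * ε * Real.sqrt (latticeSize m.1 * Real.log (latticeSize m.1)) := by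
                ring
            _ ≤ _ := by
                gcongr
                rw [hD]
                linarith)
      rw [← huD, latticeSize_headEmbed n₀ hpd] at h3
      have hu0 : 0 ≤ u (latticeSize m.1) := measureReal_nonneg
      set v := latticeSize m.1 * u (latticeSize m.1) with hv
      have hv0 : 0 ≤ v := mul_nonneg hH0.le hu0
      have h4 : latticeSize n₀ * latticeSize m.1 * (κ₂ * u (latticeSize m.1)) = c * v := by
        rw [hv, hc]; ring
      rw [h4] at h3
      have h5 : min 1 v ≤ max 1 c⁻¹ * min 1 (c * v) := by
        rw [mul_min_of_nonneg _ _ (by positivity), mul_one]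
        refine min_le_min (le_max_left _ _) ?_
        calc v = c⁻¹ * (c * v) := by rw [inv_mul_cancel_left₀ hc0.ne']
          _ ≤ _ := by
            gcongr
            exact le_max_right _ _
      simp only [Function.comp_apply]
      rw [latticeSize_headEmbed n₀ hpd, Real.mul_rpow hn₀.le hH0.le]
      set pr := P.real {ω | logNorming (k + 1) α (headEmbed n₀ m.1) * ε ≤
        maxAbsPartialSum X (headEmbed n₀ m.1) ω}
      have h6 : (0 : ℝ) < latticeSize n₀ ^ (r / 2 - 2) := by positivity
      calc latticeSize m.1 ^ (r / 2 - 2) * min 1 v ≤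
            latticeSize m.1 ^ (r / 2 - 2) * (max 1 c⁻¹ * (4 * pr)) := by
            gcongr
            refine h5.trans ?_
            gcongr
        _ = _ := by field_simp
  have h3 := summable_of_summable_min (s := r / 2) (by linarith) (fun _ => measureReal_nonneg)
    (fun _ => measureReal_le_one) hanti h2
  have h4 := (logMomentFinite_of_summable hr (hξ.const_mul D⁻¹) h3).const_mul
    (hξ.const_mul D⁻¹) hD0
  simpa only [mul_inv_cancel_left₀ hD0.ne'] using h4

end Converse

end

/-! ### Both halves together -/

theorem theorem3 {d : ℕ} (hd : 2 ≤ d)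
    {Ω Ω' : Type*} [MeasurableSpace Ω] [MeasurableSpace Ω']
    (P : Measure Ω) [IsProbabilityMeasure P] (Q : Measure Ω') [IsProbabilityMeasure Q]
    (X : (Fin d → ℕ+) → Ω → ℝ) (ξ : Ω' → ℝ)
    (hX : ∀ k, Measurable (X k)) (hξ : Measurable ξ)
    (hX_int : ∀ k, Integrable (X k) P) (hX_mean : ∀ k, ∫ ω, X k ω ∂P = 0)
    (hX_nd : NegativelyDependent X P)
    (κ₁ κ₂ : ℝ) (n₀ : Fin d → ℕ+) (x₀ : ℝ)
    (hX_wmb : WeaklyMeanBounded X P ξ Q κ₁ κ₂ n₀ x₀)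
    (r : ℝ) (hr : 2 ≤ r)
    (α : Fin d → ℝ) (hα_mono : Monotone α) (hα_one : α ⟨0, by omega⟩ = 1 / 2)
    (p : ℕ) (hp : IsGreatest {k : ℕ | ∃ i : Fin d, k = i.val + 1 ∧ α i = α ⟨0, by omega⟩} p) :
    (∀ σ : ℝ, Integrable (fun ω => ξ ω ^ 2) Q → ∫ ω, ξ ω ^ 2 ∂Q = σ ^ 2 →
      LogMomentFinite ξ Q r p →
      ∀ ε : ℝ, Real.sqrt (sigmaOneSq κ₁ n₀ x₀ σ) * Real.sqrt (r - 2) < ε →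
        Summable (fun n : {n : Fin d → ℕ+ // 1 < headProd p n} =>
          latticeSize n.1 ^ (r / 2 - 2) *
            P.real {ω | logNorming p α n.1 * ε ≤ |partialSum X n.1 ω|})) ∧
    ((r = 2 ∧ 2 ≤ p) ∨ 2 < r →
      (∃ ε : ℝ, 0 < ε ∧
        Summable (fun n : {n : Fin d → ℕ+ // 1 < headProd p n} =>
          latticeSize n.1 ^ (r / 2 - 2) *
            P.real {ω | logNorming p α n.1 * ε ≤ maxAbsPartialSum X n.1 ω})) →
      LogMomentFinite ξ Q r p) := by
  have hhead : ∃ i : Fin d, p = i.val + 1 ∧ α i = α ⟨0, by omega⟩ := hp.1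
  have htail : ∀ i : Fin d, p ≤ i.val → 1 / 2 < α i := by
    intro i hi
    have h1 : α ⟨0, by omega⟩ ≤ α i := hα_mono (Nat.zero_le _)
    rw [← hα_one]
    -- Indices start at 0, so `i.val ≥ p` is coordinate number `i.val + 1 > p`; equality would
    -- contradict the maximality of `p`.
    refine lt_of_le_of_ne h1 fun he => ?_
    have h2 := hp.2 ⟨i, rfl, he.symm⟩
    omega
  obtain ⟨i, hi, -⟩ := hhead
  have hp1 : 1 ≤ p := by omega
  have hpd : p ≤ d := by have := i.isLt; omega
  refine ⟨fun σ hint hσ hmom ε hε => ?_, fun _ ⟨ε, hε, hsum⟩ => ?_⟩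
  · exact hX_nd.summable_measureReal_abs_partialSum (by omega) hX hξ hX_int hX_mean hX_wmb hint hσ
      hp1 hpd htail hr hmom hε
  · exact hX_nd.logMomentFinite hX hξ hX_wmb hp1 hpd hr hε hsum
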